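/- **Setting.** Let $M$ be a connected smooth manifold of dimension $n\ge 2$ (orientable and oriented), $\pi\colon TM\to M$, and $A\subseteq TM$ an open set with $\pi(A)=M$ that is conic ($\lambda v\in A$ for $v\in A$, $\lambda>0$). An $A$-anisotropic tensor field assigns smoothly to each $v\in A$ a tensor on $T_{\pi(v)}M$; $\mathcal T^r_s(M_A)$ denotes those of type $(r,s)$, and $\mathfrak X(M_A)=\mathcal T^1_0(M_A)$. Let $L\colon A\to\mathbb R$ be a pseudo-Finsler metric: smooth, positively $2$-homogeneous, with non-degenerate fundamental tensor $g_v=\tfrac12\,\mathrm{Hess}(L|_{A\cap T_{\pi(v)}M})_v$. In the coordinates $(x,y)$ of $TM$ induced by a chart, let $\gamma^i_{jk}=\tfrac12 g^{ic}(\partial_{x^k}g_{cj}+\partial_{x^j}g_{ck}-\partial_{x^c}g_{jk})$ and $C_{ijk}=\tfrac12\partial_{y^k}g_{ij}$. The metric nonlinear connection $\mathrm HA$ has coefficients $N^i_j=\gamma^i_{jk}y^k-C^i_{jk}\gamma^k_{ab}y^ay^b$; put $\delta_i=\partial_{x^i}-N_i^j\partial_{y^j}$. The Chern anisotropic connection $\nabla$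 has Christoffel symbols $\Gamma^i_{jk}=\tfrac12 g^{il}(\delta_k g_{lj}+\delta_j g_{lk}-\delta_l g_{jk})$; its underlying nonlinear connection has coefficients $\Gamma^i_{jk}y^k$, and the covariant derivative of an anisotropic tensor is $\nabla_kT^{i\dots}_{j\dots}=\delta_kT^{i\dots}_{j\dots}+\Gamma^{i}_{kl}T^{l\dots}_{j\dots}+\dots-\Gamma^l_{kj}T^{i\dots}_{l\dots}-\dots$, with the $\delta_k$ of that underlying connection. For $Z\in\mathfrak X(M_A)$, the anisotropic Lie bracket with respect to $\mathrm HA$ acts on covariant tensors by $$(\mathfrak l^{\mathrm H}_ZS)_{j_1\dots j_s}=Z^k\delta_kS_{j_1\dots j_s}+\sum_{\nu=1}^s(\delta_{j_\nu}Z^k)\,S_{j_1\dots k\dots j_s},$$ with $k$ in the $\nu$-th place. With $d\mathrm{Vol}=\sqrt{|\det g_{ab}|}\,dx^1\wedge\dots\wedge dx^n$, the divergence of $Z$ is the function on $A$ defined by $\mathfrak l^{\mathrm H}_Z(d\mathrm{Vol})=\mathrm{div}(Z)\,d\mathrm{Vol}$. For $T\in\mathcal T^1_1(M_A)$, seen as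 an endomorphism, $T^\flat(X,Y)=g(X,T(Y))$, and $T(\nabla X)$ is the endomorphism field $u\mapsto T(\nabla_uX)$. **Proposition.** Let $S\in\mathcal T^0_2(M_A)$ (a $2$-covariant anisotropic tensor) be symmetric, $v\in A$, $T\in\mathcal T^1_1(M_A)$ and $X\in\mathfrak X(M_A)$. (A) The following are equivalent: - (Ai) $S_v(-,\nabla^v_-X)$ is antisymmetric, i.e. $S_v(a,\nabla^v_bX)=-S_v(b,\nabla^v_aX)$ for all $a,b\in T_{\pi(v)}M$. - (Aii) $\nabla^vX$ is anti-self-adjoint with respect to $S_v$: $S_v(\nabla^v_aX,b)=-S_v(a,\nabla^v_bX)$ for all $a,b$. - (Aiii) $(\mathfrak l^{\mathrm H}_XS)_v=\nabla^v_XS$. (B) On $A$, $$\mathrm{div}(T(X))-\mathrm{trace}(T(\nabla X))=\mathbf C^1_2(\nabla T)(X),$$ where $\mathbf C^1_2$ contracts the contravariant index with the covariant one introduced by $\nabla$, i.e. $\mathbf C^1_2(\nabla T)_j=\nabla_iT^i_j$. (C) One has $\mathrm{trace}(T(\nabla X))(v)=0$ under either of the following conditions: - (Ci) $T^\flat_v(-,\nabla^v_-X)$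 is antisymmetric. - (Cii) $T^\flat_v$ is symmetric and $(\mathfrak l^{\mathrm H}_Xg)_v=0$. -/

import Mathlib

open scoped Manifold ContDiff Topology

noncomputable section

namespace AnisotropicTensors

/-- The model space `ℝⁿ` of the manifold. -/
abbrev Coord (n : ℕ) : Type := EuclideanSpace ℝ (Fin n)

section Fields

variable (n : ℕ) (M : Type*) [TopologicalSpace M] [ChartedSpace (Coord n) M]

/-- The tangent bundle `TM`; `v : TM n M` has base point `v.proj` and vector part `v.2`. -/
abbrev TM := TangentBundle 𝓘(ℝ, Coord n) M

variable {M} in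
/-- The tangent space `T_pM`. -/
abbrev Tan (p : M) := TangentSpace 𝓘(ℝ, Coord n) p

/-- Anisotropic vector fields `X`: `X_v ∈ T_{π(v)}M`. Fields are total functions of `v ∈ TM`; only
their values on the domain `A` matter. -/
abbrev VectorFieldA := (v : TM n M) → Tan n v.proj

/-- Anisotropic tensor fields of type `(1,1)`, seen as endomorphisms. -/
abbrev EndFieldA := (v : TM n M) → (Tan n v.proj →L[ℝ] Tan n v.proj)

/-- Anisotropic `s`-covariant tensor fields. -/
abbrev CovFieldA (s : ℕ) :=
  (v : TM n M) → ContinuousMultilinearMap ℝ (fun _ : Fin s => Tan n v.proj) ℝ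

end Fields

section PseudoFinsler

variable {n : ℕ} {M : Type*} [TopologicalSpace M] [ChartedSpace (Coord n) M]

/-- Half of the vertical Hessian of `L : TM → ℝ`, i.e. half of the second derivative at `v` of the
restriction of `L` to the vector space `T_{π(v)}M`. -/
def halfVerticalHessian (L : TM n M → ℝ) : CovFieldA n M 2 := fun v =>
  (1 / 2 : ℝ) • iteratedFDeriv ℝ 2 (fun y : Coord n => L ⟨v.proj, y⟩) v.2

end PseudoFinsler

/-- A pseudo-Finsler metric `L` on a conic open domain `A ⊆ TM` with `π(A) = M`. The value of `L`
outside `A` is irrelevant. -/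
structure PseudoFinslerMetric (n : ℕ) (M : Type*) [TopologicalSpace M]
    [ChartedSpace (Coord n) M] [IsManifold 𝓘(ℝ, Coord n) ∞ M] where
  /-- the domain `A` -/
  A : Set (TM n M)
  isOpen_A : IsOpen A
  proj_A : ∀ p : M, ∃ v ∈ A, v.proj = p
  conic_A : ∀ v ∈ A, ∀ c : ℝ, 0 < c → (⟨v.proj, c • v.2⟩ : TM n M) ∈ A
  /-- the metric `L` -/
  L : TM n M → ℝ
  smooth_L : ContMDiffOn 𝓘(ℝ, Coord n).tangent 𝓘(ℝ, ℝ) ∞ L A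
  homogeneous_L : ∀ v ∈ A, ∀ c : ℝ, 0 < c → L ⟨v.proj, c • v.2⟩ = c ^ 2 * L v
  nondegenerate : ∀ v ∈ A, ∀ u : Tan n v.proj,
    (∀ w : Tan n v.proj, halfVerticalHessian L v ![u, w] = 0) → u = 0

section Coordinates

variable {n : ℕ} {M : Type*} [TopologicalSpace M] [ChartedSpace (Coord n) M]

/-! The operators on anisotropic tensors are given by their coordinate expressions in a chart `φ`
of the maximal atlas; their values at `v` are tensors on `T_{π(v)}M`. -/

variable (φ : OpenPartialHomeomorph M (Coord n))

/-- The tangent vector with coordinates `(x, y)` in the chart of `TM` induced by `φ`. -/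
def ofCoord (x y : Coord n) : TM n M :=
  ⟨φ.symm x, mfderiv 𝓘(ℝ, Coord n) 𝓘(ℝ, Coord n) φ.symm x y⟩

/-- The coordinate covectors `dxⁱ` at `p`. -/
def dx (p : M) (i : Fin n) : Tan n p →L[ℝ] ℝ :=
  (EuclideanSpace.proj i : Coord n →L[ℝ] ℝ).comp (mfderiv 𝓘(ℝ, Coord n) 𝓘(ℝ, Coord n) φ p)

/-- The coordinate vectors `∂ᵢ` at `p`. -/
def frame (p : M) (i : Fin n) : Tan n p :=
  (mfderiv 𝓘(ℝ, Coord n) 𝓘(ℝ, Coord n) φ.symm (φ p) (EuclideanSpace.single i (1 : ℝ)) : Coord n)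

/-- The coordinates `y = (y¹, …, yⁿ)` of `v`. -/
def fiberCoord (v : TM n M) : Coord n := mfderiv 𝓘(ℝ, Coord n) 𝓘(ℝ, Coord n) φ v.proj v.2

/-- `∂f/∂xᵏ` for a function `f` on `TM`. -/
def partialX (k : Fin n) (f : TM n M → ℝ) (v : TM n M) : ℝ :=
  fderiv ℝ (fun x : Coord n => f (ofCoord φ x (fiberCoord φ v))) (φ v.proj)
    (EuclideanSpace.single k 1)

/-- `∂f/∂yᵏ` for a function `f` on `TM`. -/
def partialY (k : Fin n) (f : TM n M → ℝ) (v : TM n M) : ℝ :=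
  fderiv ℝ (fun y : Coord n => f (ofCoord φ (φ v.proj) y)) (fiberCoord φ v)
    (EuclideanSpace.single k 1)

/-- Components `Xⁱ`. -/
def compVec (X : VectorFieldA n M) (i : Fin n) (v : TM n M) : ℝ := dx φ v.proj i (X v)

/-- Components `Tⁱⱼ`. -/
def compEnd (T : EndFieldA n M) (i j : Fin n) (v : TM n M) : ℝ :=
  dx φ v.proj i (T v (frame φ v.proj j))

/-- Components `S_{j₁ … jₛ}`. -/
def compCov {s : ℕ} (S : CovFieldA n M s) (J : Fin s → Fin n) (v : TM n M) : ℝ :=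
  S v (fun a => frame φ v.proj (J a))

/-- `dx^{j₁} ⊗ … ⊗ dx^{jₛ}` at `p`. -/
def dxTensor {s : ℕ} (p : M) (J : Fin s → Fin n) :
    ContinuousMultilinearMap ℝ (fun _ : Fin s => Tan n p) ℝ :=
  (ContinuousMultilinearMap.mkPiAlgebra ℝ (Fin s) ℝ).compContinuousLinearMap
    (fun a => dx φ p (J a))

/-- `δₖ f = ∂f/∂xᵏ - Nₖʲ ∂f/∂yʲ` for the nonlinear connection with coefficients
`N j k = Nʲₖ`. -/
def delta (N : Fin n → Fin n → TM n M → ℝ) (k : Fin n) (f : TM n M → ℝ) (v : TM n M) : ℝ :=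
  partialX φ k f v - ∑ j, N j k v * partialY φ j f v

section Derivations

/-! ### The covariant derivative of an anisotropic connection

The connection is given by its Christoffel symbols `Γ i j k = Γⁱⱼₖ` in the chart `φ`, where
`∇_{∂ⱼ} ∂ₖ = Γⁱⱼₖ ∂ᵢ`. -/

variable (Γ : Fin n → Fin n → Fin n → TM n M → ℝ)

/-- The coefficients `Nⁱⱼ = Γⁱⱼₖ yᵏ` of the underlying nonlinear connection. -/
def underlying (i j : Fin n) (v : TM n M) : ℝ := ∑ k, Γ i j k v * fiberCoord φ v k

/-- `∇X`, as the endomorphism field `u ↦ ∇_u X`. -/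
def nablaVec (X : VectorFieldA n M) : EndFieldA n M := fun v =>
  ∑ k, ∑ i,
    (delta φ (underlying φ Γ) k (compVec φ X i) v + ∑ l, Γ i k l v * compVec φ X l v) •
      (dx φ v.proj k).smulRight (frame φ v.proj i)

/-- `∇T` for `T` of type `(1,1)`; `nablaEnd φ Γ T v u w = (∇ᵛ_u T)(w)`. -/
def nablaEnd (T : EndFieldA n M) (v : TM n M) :
    Tan n v.proj →L[ℝ] Tan n v.proj →L[ℝ] Tan n v.proj :=
  ∑ k, ∑ i, ∑ j,
    (delta φ (underlying φ Γ) k (compEnd φ T i j) v + ∑ l, Γ i k l v * compEnd φ T l j v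
        - ∑ l, Γ l k j v * compEnd φ T i l v) •
      (dx φ v.proj k).smulRight ((dx φ v.proj j).smulRight (frame φ v.proj i))

/-- `∇_X S` for `S` covariant. -/
def nablaCov {s : ℕ} (X : VectorFieldA n M) (S : CovFieldA n M s) : CovFieldA n M s := fun v =>
  ∑ J : Fin s → Fin n,
    (∑ k, compVec φ X k v *
      (delta φ (underlying φ Γ) k (compCov φ S J) v
        - ∑ a, ∑ l, Γ l k (J a) v * compCov φ S (Function.update J a l) v)) •
      dxTensor φ v.proj J

/-- The anisotropic Lie bracket `𝔩ᴴ_Z S` for `S` covariant, with respect to the nonlinear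
connection with coefficients `N j k = Nʲₖ`. -/
def lieCov (N : Fin n → Fin n → TM n M → ℝ) {s : ℕ} (Z : VectorFieldA n M)
    (S : CovFieldA n M s) : CovFieldA n M s := fun v =>
  ∑ J : Fin s → Fin n,
    ((∑ k, compVec φ Z k v * delta φ N k (compCov φ S J) v)
        + ∑ a, ∑ k, delta φ N (J a) (compVec φ Z k) v *
            compCov φ S (Function.update J a k) v) •
      dxTensor φ v.proj J

end Derivations

/-- `C¹₂`: contraction of the contravariant index of a `(1,2)`-tensor with its derivative index,
`R u w` being the value at the direction `u` of derivation and at the other argument `w`. -/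
def contractDir {p : M} (R : Tan n p →L[ℝ] Tan n p →L[ℝ] Tan n p) (w : Tan n p) : ℝ :=
  LinearMap.trace ℝ (Tan n p)
    { toFun := fun u => R u w
      map_add' := by simp
      map_smul' := by simp }

end Coordinates

/-- Smoothness on `A` of an anisotropic vector field: smooth components in every chart. -/
def SmoothVec {n : ℕ} {M : Type*} [TopologicalSpace M] [ChartedSpace (Coord n) M]
    [IsManifold 𝓘(ℝ, Coord n) ∞ M] (A : Set (TM n M)) (X : VectorFieldA n M) : Prop :=
  ∀ φ ∈ IsManifold.maximalAtlas 𝓘(ℝ, Coord n) ∞ M, ∀ i,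
    ContMDiffOn 𝓘(ℝ, Coord n).tangent 𝓘(ℝ, ℝ) ∞ (compVec φ X i)
      (A ∩ {v | v.proj ∈ φ.source})

/-- Smoothness on `A` of an anisotropic `(1,1)`-tensor field. -/
def SmoothEnd {n : ℕ} {M : Type*} [TopologicalSpace M] [ChartedSpace (Coord n) M]
    [IsManifold 𝓘(ℝ, Coord n) ∞ M] (A : Set (TM n M)) (T : EndFieldA n M) : Prop :=
  ∀ φ ∈ IsManifold.maximalAtlas 𝓘(ℝ, Coord n) ∞ M, ∀ i j,
    ContMDiffOn 𝓘(ℝ, Coord n).tangent 𝓘(ℝ, ℝ) ∞ (compEnd φ T i j)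
      (A ∩ {v | v.proj ∈ φ.source})

/-- Smoothness on `A` of an anisotropic covariant tensor field. -/
def SmoothCov {n : ℕ} {M : Type*} [TopologicalSpace M] [ChartedSpace (Coord n) M]
    [IsManifold 𝓘(ℝ, Coord n) ∞ M] {s : ℕ} (A : Set (TM n M)) (S : CovFieldA n M s) : Prop :=
  ∀ φ ∈ IsManifold.maximalAtlas 𝓘(ℝ, Coord n) ∞ M, ∀ J,
    ContMDiffOn 𝓘(ℝ, Coord n).tangent 𝓘(ℝ, ℝ) ∞ (compCov φ S J)
      (A ∩ {v | v.proj ∈ φ.source})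

namespace PseudoFinslerMetric

variable {n : ℕ} {M : Type*} [TopologicalSpace M] [ChartedSpace (Coord n) M]
  [IsManifold 𝓘(ℝ, Coord n) ∞ M] (F : PseudoFinslerMetric n M)

/-- The fundamental tensor `g`. -/
def g : CovFieldA n M 2 := halfVerticalHessian F.L

/-- `T^♭(a, b) = g(a, T(b))` at `v`. -/
def flat (T : EndFieldA n M) (v : TM n M) (a b : Tan n v.proj) : ℝ := F.g v ![a, T v b]

variable (φ : OpenPartialHomeomorph M (Coord n))

/-- The components `gᵢⱼ`. -/
def gComp (i j : Fin n) (v : TM n M) : ℝ := compCov φ F.g ![i, j] v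

/-- The matrix `(gᵢⱼ(v))`. -/
def gMatrix (v : TM n M) : Matrix (Fin n) (Fin n) ℝ := Matrix.of fun i j => F.gComp φ i j v

/-- The inverse matrix entries `gⁱʲ`. -/
def gInv (i j : Fin n) (v : TM n M) : ℝ := (F.gMatrix φ v)⁻¹ i j

/-- The Cartan tensor `C_{ijk} = ½ ∂g_{ij}/∂yᵏ`. -/
def cartan (i j k : Fin n) (v : TM n M) : ℝ := 1 / 2 * partialY φ k (F.gComp φ i j) v

/-- The formal Christoffel symbols `γⁱⱼₖ` of `g`. -/
def formalChristoffel (i j k : Fin n) (v : TM n M) : ℝ :=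
  1 / 2 * ∑ c, F.gInv φ i c v *
    (partialX φ k (F.gComp φ c j) v + partialX φ j (F.gComp φ c k) v
      - partialX φ c (F.gComp φ j k) v)

/-- The coefficients `Nⁱⱼ = γⁱⱼₖ yᵏ - Cⁱⱼₖ γᵏ_{ab} yᵃ yᵇ` of the metric nonlinear connection,
with `Cⁱⱼₖ = gⁱˡ C_{ljk}`. -/
def metricN (i j : Fin n) (v : TM n M) : ℝ :=
  (∑ k, F.formalChristoffel φ i j k v * fiberCoord φ v k)
    - ∑ k, (∑ l, F.gInv φ i l v * F.cartan φ l j k v) *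
        ∑ a, ∑ b, F.formalChristoffel φ k a b v * fiberCoord φ v a * fiberCoord φ v b

/-- The Christoffel symbols `Γⁱⱼₖ` of the Chern anisotropic connection. -/
def chern (i j k : Fin n) (v : TM n M) : ℝ :=
  1 / 2 * ∑ l, F.gInv φ i l v *
    (delta φ (F.metricN φ) k (F.gComp φ l j) v + delta φ (F.metricN φ) j (F.gComp φ l k) v
      - delta φ (F.metricN φ) l (F.gComp φ j k) v)

/-- The metric volume form `√|det g_{ab}| dx¹ ∧ … ∧ dxⁿ` on the domain of the chart `φ`, oriented
by `φ`. -/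
def dVol : CovFieldA n M n := fun v =>
  √|(F.gMatrix φ v).det| •
    ∑ σ : Equiv.Perm (Fin n), (Equiv.Perm.sign σ : ℝ) • dxTensor φ v.proj σ

/-- The divergence of an anisotropic vector field: the factor `div(Z)` in
`𝔩ᴴ_Z(dVol) = div(Z) dVol`, where `H` is the metric nonlinear connection. It is read off on the
frame `∂₁, …, ∂ₙ`, which determines it as both sides are forms of top degree (see
`lieCov_dVol` below). It does not depend on the orientation. -/
def divergence (Z : VectorFieldA n M) (v : TM n M) : ℝ :=
  compCov φ (lieCov φ (F.metricN φ) Z (F.dVol φ)) id v / compCov φ (F.dVol φ) id v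

/-- The covariant derivative `∇X` for the Chern connection. -/
def nabla (X : VectorFieldA n M) : EndFieldA n M := nablaVec φ (F.chern φ) X

/-! ### The divergence is well defined by `𝔩ᴴ_Z(dVol) = div(Z) dVol` -/

section WellDefined

variable {φ}

theorem mdiff (hφ : φ ∈ IsManifold.maximalAtlas 𝓘(ℝ, Coord n) ∞ M) :
    φ.MDifferentiable 𝓘(ℝ, Coord n) 𝓘(ℝ, Coord n) :=
  ⟨(contMDiffOn_of_mem_maximalAtlas hφ).mdifferentiableOn (by simp),
    (contMDiffOn_symm_of_mem_maximalAtlas hφ).mdifferentiableOn (by simp)⟩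

theorem dx_frame (hφ : φ ∈ IsManifold.maximalAtlas 𝓘(ℝ, Coord n) ∞ M) {p : M}
    (hp : p ∈ φ.source) (i j : Fin n) :
    dx φ p i (frame φ p j) = if i = j then 1 else 0 := by
  have h := (mdiff hφ).comp_symm_deriv (φ.map_source hp)
  rw [φ.left_inv hp] at h
  have h2 := congrArg (fun L : Coord n →L[ℝ] Coord n => L (EuclideanSpace.single j (1 : ℝ)) i) h
  refine Eq.trans ?_ (h2.trans ?_)
  · rfl
  · change (EuclideanSpace.single j (1 : ℝ)) i = _
    simp

theorem sum_dx_frame (hφ : φ ∈ IsManifold.maximalAtlas 𝓘(ℝ, Coord n) ∞ M) {p : M}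
    (hp : p ∈ φ.source) (u : Tan n p) :
    u = ∑ j, dx φ p j u • frame φ p j := by
  have h := (mdiff hφ).symm_comp_deriv hp
  have h2 := congrArg (fun L : Coord n →L[ℝ] Coord n => L u) h
  refine (Eq.trans ?_ h2).symm
  set D : Coord n →L[ℝ] Coord n := mfderiv 𝓘(ℝ, Coord n) 𝓘(ℝ, Coord n) φ.symm (φ p) with hD
  set y : Coord n := mfderiv 𝓘(ℝ, Coord n) 𝓘(ℝ, Coord n) φ p u with hy
  change (∑ j, y j • D (EuclideanSpace.single j (1 : ℝ)) : Coord n) = D y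
  have : y = ∑ j, y j • EuclideanSpace.single j (1 : ℝ) := by
    ext i
    simp [Pi.single_apply]
  conv_rhs => rw [this]
  simp

theorem dxTensor_frame (hφ : φ ∈ IsManifold.maximalAtlas 𝓘(ℝ, Coord n) ∞ M) {p : M}
    (hp : p ∈ φ.source) {s : ℕ} (J K : Fin s → Fin n) :
    dxTensor φ p J (fun a => frame φ p (K a)) = if J = K then 1 else 0 := by
  simp only [dxTensor, ContinuousMultilinearMap.compContinuousLinearMap_apply,
    ContinuousMultilinearMap.mkPiAlgebra_apply, dx_frame hφ hp]
  split_ifs with h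
  · simp [h]
  · obtain ⟨a, ha⟩ := Function.ne_iff.mp h
    exact Finset.prod_eq_zero (Finset.mem_univ a) (by simp [ha])

/-- The sign of `J` if it is a permutation, and `0` otherwise. -/
def eps (J : Fin n → Fin n) : ℝ :=
  (Matrix.of fun i a : Fin n => if i = J a then (1 : ℝ) else 0).det

theorem eps_perm (σ : Equiv.Perm (Fin n)) : eps (σ : Fin n → Fin n) = Equiv.Perm.sign σ := by
  have : (Matrix.of fun i a : Fin n => if i = σ a then (1 : ℝ) else 0)
      = (σ.permMatrix ℝ).transpose := by
    ext i a
    simp [Equiv.Perm.permMatrix, PEquiv.toMatrix_apply, eq_comm]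
  rw [eps, this, Matrix.det_transpose, Matrix.det_permutation]

theorem sum_perm_dx (p : M) :
    ∑ σ : Equiv.Perm (Fin n), (Equiv.Perm.sign σ : ℝ) • dxTensor φ p σ
      = ∑ J : Fin n → Fin n, eps J • dxTensor φ p J := by
  refine Fintype.sum_of_injective (fun σ : Equiv.Perm (Fin n) => (σ : Fin n → Fin n))
    DFunLike.coe_injective _ _ ?_ ?_
  · intro J hJ
    have hinj : ¬ Function.Injective J := fun h =>
      hJ ⟨Equiv.ofBijective J (Finite.injective_iff_bijective.mp h), rfl⟩
    simp only [Function.Injective, not_forall] at hinj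
    obtain ⟨a, b, hab, hne⟩ := hinj
    have : eps J = 0 := Matrix.det_zero_of_column_eq hne (by intro i; simp [hab])
    simp [this]
  · intro σ
    simp [eps_perm]

theorem dVol_eq (v : TM n M) : F.dVol φ v =
    ∑ J : Fin n → Fin n, (√|(F.gMatrix φ v).det| * eps J) • dxTensor φ v.proj J := by
  rw [dVol, sum_perm_dx, Finset.smul_sum]
  simp [smul_smul]

theorem compCov_sum (hφ : φ ∈ IsManifold.maximalAtlas 𝓘(ℝ, Coord n) ∞ M) {s : ℕ}
    (S : CovFieldA n M s) (c : (Fin s → Fin n) → ℝ) {v : TM n M} (hv : v.proj ∈ φ.source)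
    (hS : S v = ∑ J, c J • dxTensor φ v.proj J) (K : Fin s → Fin n) : compCov φ S K v = c K := by
  simp [compCov, hS, dxTensor_frame hφ hv]

theorem delta_const_mul (N : Fin n → Fin n → TM n M → ℝ) (k : Fin n)
    (f h : TM n M → ℝ) (c : ℝ) (hf : ∀ w : TM n M, w.proj ∈ φ.source → f w = c * h w)
    {v : TM n M} (hv : v.proj ∈ φ.source) : delta φ N k f v = c * delta φ N k h v := by
  have key : ∀ (q r : Coord n → ℝ) (z : Coord n), q =ᶠ[𝓝 z] (c • r) →
      fderiv ℝ q z (EuclideanSpace.single k 1) = c * fderiv ℝ r z (EuclideanSpace.single k 1) := by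
    intro q r z hq
    rw [hq.fderiv_eq, fderiv_const_smul_field]
    simp
  have h1 : partialX φ k f v = c * partialX φ k h v := by
    refine key _ _ _ ?_
    filter_upwards [φ.open_target.mem_nhds (φ.map_source hv)] with x hx
    exact hf _ (φ.map_target hx)
  have h2 : ∀ j, partialY φ j f v = c * partialY φ j h v := by
    intro j
    have : (fun y : Coord n => f (ofCoord φ (φ v.proj) y))
        = c • (fun y : Coord n => h (ofCoord φ (φ v.proj) y)) := by
      ext y
      exact hf _ (φ.map_target (φ.map_source hv))
    rw [partialY, this, fderiv_const_smul_field]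
    simp [partialY]
  rw [delta, delta, h1, mul_sub, Finset.mul_sum]
  simp only [h2]
  congr 1
  exact Finset.sum_congr rfl fun j _ => by ring

theorem sum_eps_update (D : Fin n → Fin n → ℝ) (J : Fin n → Fin n) :
    ∑ a, ∑ k, D (J a) k * eps (Function.update J a k) = (∑ a, D a a) * eps J := by
  set P : Matrix (Fin n) (Fin n) ℝ := Matrix.of fun i a => if i = J a then (1 : ℝ) else 0 with hP
  set B : Matrix (Fin n) (Fin n) ℝ := Matrix.of fun i j => D j i with hB
  have h1 : ∀ a k, eps (Function.update J a k) = P.adjugate a k := by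
    intro a k
    have : (Matrix.of fun i b : Fin n => if i = Function.update J a k b then (1 : ℝ) else 0)
        = P.updateCol a (Pi.single k 1) := by
      ext i b
      by_cases hb : b = a
      · subst hb; simp [Pi.single_apply]
      · simp [hb, hP]
    rw [eps, this, ← Matrix.cramer_apply, Matrix.cramer_eq_adjugate_mulVec]
    simp
  have h2 : ∀ a k, D (J a) k = (B * P) k a := by
    intro a k
    simp [Matrix.mul_apply, hB, hP]
  calc ∑ a, ∑ k, D (J a) k * eps (Function.update J a k)
      = (P.adjugate * (B * P)).trace := by
        simp only [Matrix.trace, Matrix.diag, Matrix.mul_apply (M := P.adjugate), h1, h2]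
        exact Finset.sum_congr rfl fun a _ => Finset.sum_congr rfl fun k _ => mul_comm _ _
    _ = (P * P.adjugate * B).trace := by
        rw [← Matrix.mul_assoc, Matrix.trace_mul_comm, Matrix.mul_assoc]
    _ = (∑ a, D a a) * eps J := by
        rw [Matrix.mul_adjugate, Matrix.smul_mul, Matrix.one_mul, Matrix.trace_smul, smul_eq_mul,
          mul_comm]
        rfl

theorem det_gMatrix_ne_zero (hφ : φ ∈ IsManifold.maximalAtlas 𝓘(ℝ, Coord n) ∞ M) {v : TM n M}
    (hv : v ∈ F.A) (hvφ : v.proj ∈ φ.source) : (F.gMatrix φ v).det ≠ 0 := by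
  intro h0
  obtain ⟨c, hc, hc0⟩ := Matrix.exists_vecMul_eq_zero_iff.mpr h0
  have lin1 : ∀ (w : Tan n v.proj) (d : Fin n → ℝ),
      F.g v ![∑ j, d j • frame φ v.proj j, w] = ∑ j, d j * F.g v ![frame φ v.proj j, w] := by
    intro w d
    set l := (F.g v).toMultilinearMap.toLinearMap ![0, w] 0 with hl
    have e : ∀ u, F.g v ![u, w] = l u := fun u => by
      change F.g v _ = F.g v _
      congr 1
      funext a
      fin_cases a <;> rfl
    simp only [e, map_sum, map_smul, smul_eq_mul]
  have lin2 : ∀ (w : Tan n v.proj) (d : Fin n → ℝ),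
      F.g v ![w, ∑ j, d j • frame φ v.proj j] = ∑ j, d j * F.g v ![w, frame φ v.proj j] := by
    intro w d
    set l := (F.g v).toMultilinearMap.toLinearMap ![w, 0] 1 with hl
    have e : ∀ u, F.g v ![w, u] = l u := fun u => by
      change F.g v _ = F.g v _
      congr 1
      funext a
      fin_cases a <;> rfl
    simp only [e, map_sum, map_smul, smul_eq_mul]
  have hu := F.nondegenerate v hv (∑ j, c j • frame φ v.proj j) (by
    intro w
    change F.g v ![_, w] = 0
    rw [sum_dx_frame hφ hvφ w, lin2]
    refine Finset.sum_eq_zero fun i _ => ?_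
    rw [lin1]
    have h3 := congrFun hc0 i
    have h4 : ∀ j, F.gMatrix φ v j i = F.g v ![frame φ v.proj j, frame φ v.proj i] := by
      intro j
      change F.g v _ = _
      congr 1
      ext a
      fin_cases a <;> rfl
    simp only [Matrix.vecMul, dotProduct, h4, Pi.zero_apply] at h3
    rw [h3, mul_zero])
  apply hc
  ext i
  have h5 := congrArg (dx φ v.proj i) hu
  simpa [dx_frame hφ hvφ] using h5

/-- `𝔩ᴴ_Z(dVol) = div(Z) dVol`. -/
theorem lieCov_dVol (hφ : φ ∈ IsManifold.maximalAtlas 𝓘(ℝ, Coord n) ∞ M) (Z : VectorFieldA n M)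
    {v : TM n M} (hv : v ∈ F.A) (hvφ : v.proj ∈ φ.source) :
    lieCov φ (F.metricN φ) Z (F.dVol φ) v = F.divergence φ Z v • F.dVol φ v := by
  have hcomp : ∀ w : TM n M, w.proj ∈ φ.source → ∀ J : Fin n → Fin n,
      compCov φ (F.dVol φ) J w = √|(F.gMatrix φ w).det| * eps J :=
    fun w hw J => compCov_sum hφ _ _ hw (F.dVol_eq w) J
  have hid : eps (id : Fin n → Fin n) = 1 := by
    simpa using eps_perm (1 : Equiv.Perm (Fin n))
  have hpos : √|(F.gMatrix φ v).det| ≠ 0 :=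
    (Real.sqrt_pos.mpr (abs_pos.mpr (F.det_gMatrix_ne_zero hφ hv hvφ))).ne'
  obtain ⟨q, hq⟩ : ∃ q : ℝ, lieCov φ (F.metricN φ) Z (F.dVol φ) v =
      ∑ J : Fin n → Fin n, (q * eps J) • dxTensor φ v.proj J := by
    refine ⟨(∑ k, compVec φ Z k v *
      delta φ (F.metricN φ) k (fun w => √|(F.gMatrix φ w).det|) v) +
      √|(F.gMatrix φ v).det| * ∑ a, delta φ (F.metricN φ) a (compVec φ Z a) v, ?_⟩
    refine Finset.sum_congr rfl fun J _ => ?_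
    congr 1
    have e1 : ∀ k, delta φ (F.metricN φ) k (compCov φ (F.dVol φ) J) v =
        eps J * delta φ (F.metricN φ) k (fun w => √|(F.gMatrix φ w).det|) v := fun k =>
      delta_const_mul _ _ _ _ _ (fun w hw => by rw [hcomp w hw, mul_comm]) hvφ
    simp only [e1, hcomp v hvφ]
    rw [add_mul, mul_assoc, ← sum_eps_update (fun j k => delta φ (F.metricN φ) j (compVec φ Z k) v),
      Finset.sum_mul, Finset.mul_sum]
    congr 1
    · exact Finset.sum_congr rfl fun k _ => by ring
    · refine Finset.sum_congr rfl fun a _ => ?_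
      rw [Finset.mul_sum]
      exact Finset.sum_congr rfl fun k _ => by ring
  have hdiv : F.divergence φ Z v = q / √|(F.gMatrix φ v).det| := by
    rw [divergence, compCov_sum hφ _ _ hvφ hq, hcomp v hvφ, hid, mul_one, mul_one]
  rw [hq, hdiv, dVol_eq, Finset.smul_sum]
  refine Finset.sum_congr rfl fun J _ => ?_
  rw [smul_smul]
  congr 1
  field_simp

end WellDefined

end PseudoFinslerMetric

end AnisotropicTensors

end

/-! Everything is a pointwise computation at `v` in the chart `φ`, and it rests on three properties
of the Chern symbols. They are symmetric in the lower indices (`chern_symm`); their underlying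
nonlinear connection is the metric one (`underlying_chern`), so `∇` and the Lie bracket use the same
`δₖ`; and they parallelize `g` (`delta_gComp_eq`, hence `nablaCov_g`). The second one is where
homogeneity enters: by Euler's relation `C_{ijk} yᵏ = 0`, and `C` is totally symmetric.

(A) The first two properties give `𝔩ᴴ_X S - ∇_X S = S(∇X, ·) + S(·, ∇X)`
(`lieCov_two_sub_nablaCov`), which makes (Aiii) the same as (Aii). The symmetry of `S` exchanges
(Ai) and (Aii).

(B) Jacobi's formula gives `δₖ √|det g| = √|det g| Γⁱᵢₖ` (`delta_sqrt_det`), so `div Z = δₐZᵃ + Γⁱᵢₖ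
Zᵏ`, the trace of `∇Z`. For `Z = T(X)` the Leibniz rule splits this into `trace (T(∇X))` and the
contraction of `∇T`.

(C) A trace is `trace E = gʲⁱ g(∂ⱼ, E ∂ᵢ)`, which vanishes when `g(·, E ·)` is antisymmetric. Under
(Cii), part (A) for `S = g` makes `∇X` anti-self-adjoint while `T` is self-adjoint, so `trace (T ∇X)
= -trace (∇X T) = -trace (T ∇X)`. -/

noncomputable section

namespace AnisotropicTensors

/-! ### Anisotropic functions read in the induced coordinates of `TM`. -/

section CoordinateCalculus

variable {n : ℕ} {M : Type*} [TopologicalSpace M] [ChartedSpace (Coord n) M]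

/-- The coordinate expression `(x, y) ↦ f(x, y)` of a function on `TM`. -/
def localRep (φ : OpenPartialHomeomorph M (Coord n)) (f : TM n M → ℝ) (z : Coord n × Coord n) : ℝ :=
  f (ofCoord φ z.1 z.2)

/-- The coordinates `(x, y)` of `v`. -/
def coordOf (φ : OpenPartialHomeomorph M (Coord n)) (v : TM n M) : Coord n × Coord n :=
  (φ v.proj, fiberCoord φ v)

/-- The coordinate expression of the part over the chart domain of a subset of `TM`. -/
def localDomain (φ : OpenPartialHomeomorph M (Coord n)) (A : Set (TM n M)) :
    Set (Coord n × Coord n) :=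
  {z | z.1 ∈ φ.target ∧ ofCoord φ z.1 z.2 ∈ A}

/-- The coordinate expression of the `k`-th horizontal vector `∂/∂xᵏ - Nₖʲ ∂/∂yʲ` at `v`. -/
def horizontal (N : Fin n → Fin n → TM n M → ℝ) (k : Fin n) (v : TM n M) : Coord n × Coord n :=
  (EuclideanSpace.single k 1, -∑ j, N j k v • EuclideanSpace.single j (1 : ℝ))

variable {φ : OpenPartialHomeomorph M (Coord n)}

theorem partialX_eq (k : Fin n) {f : TM n M → ℝ} {v : TM n M}
    (hf : DifferentiableAt ℝ (localRep φ f) (coordOf φ v)) :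
    partialX φ k f v = fderiv ℝ (localRep φ f) (coordOf φ v) (EuclideanSpace.single k 1, 0) := by
  have h : HasFDerivAt (fun x : Coord n => (x, fiberCoord φ v))
      (ContinuousLinearMap.inl ℝ (Coord n) (Coord n)) (φ v.proj) := hasFDerivAt_prodMk_left _ _
  have h2 := (HasFDerivAt.comp (φ v.proj) (g := localRep φ f) hf.hasFDerivAt h).fderiv
  rw [partialX]
  change fderiv ℝ (localRep φ f ∘ fun x : Coord n => (x, fiberCoord φ v)) _ _ = _
  rw [h2]
  simp

theorem partialY_eq (k : Fin n) {f : TM n M → ℝ} {v : TM n M}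
    (hf : DifferentiableAt ℝ (localRep φ f) (coordOf φ v)) :
    partialY φ k f v = fderiv ℝ (localRep φ f) (coordOf φ v) (0, EuclideanSpace.single k 1) := by
  have h : HasFDerivAt (fun y : Coord n => (φ v.proj, y))
      (ContinuousLinearMap.inr ℝ (Coord n) (Coord n)) (fiberCoord φ v) :=
    hasFDerivAt_prodMk_right _ _
  have h2 := (HasFDerivAt.comp (fiberCoord φ v) (g := localRep φ f) hf.hasFDerivAt h).fderiv
  rw [partialY]
  change fderiv ℝ (localRep φ f ∘ fun y : Coord n => (φ v.proj, y)) _ _ = _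
  rw [h2]
  simp

/-- Given joint differentiability, `δₖ` is one directional derivative in `(x, y)`, so the Leibniz
and chain rules for it become those of `fderiv`. -/
theorem delta_eq (N : Fin n → Fin n → TM n M → ℝ) (k : Fin n) {f : TM n M → ℝ} {v : TM n M}
    (hf : DifferentiableAt ℝ (localRep φ f) (coordOf φ v)) :
    delta φ N k f v = fderiv ℝ (localRep φ f) (coordOf φ v) (horizontal N k v) := by
  have h : horizontal N k v = (EuclideanSpace.single k (1 : ℝ), (0 : Coord n))
      - ∑ j, N j k v • ((0 : Coord n), EuclideanSpace.single j (1 : ℝ)) := by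
    ext <;> simp [horizontal, Prod.fst_sum, Prod.snd_sum]
  rw [delta, partialX_eq k hf, h]
  simp only [partialY_eq _ hf, map_sub, map_sum, map_smul, smul_eq_mul]

theorem ofCoord_coordOf [IsManifold 𝓘(ℝ, Coord n) ∞ M]
    (hφ : φ ∈ IsManifold.maximalAtlas 𝓘(ℝ, Coord n) ∞ M) {v : TM n M}
    (hv : v.proj ∈ φ.source) : ofCoord φ (coordOf φ v).1 (coordOf φ v).2 = v := by
  have h := (PseudoFinslerMetric.mdiff hφ).symm_comp_deriv hv
  have h2 := congrArg (fun L : Coord n →L[ℝ] Coord n => L v.2) h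
  obtain ⟨p, y⟩ := v
  have hp : φ.symm (φ p) = p := φ.left_inv hv
  -- The base points `φ.symm (φ p)` and `p` are equal only propositionally, so the fibres differ as
  -- types. Viewing both vectors in the model space `Coord n` allows substitution.
  have key : ∀ (q : M) (w : Coord n), q = p → w = y →
      (⟨q, w⟩ : TM n M) = (⟨p, y⟩ : TM n M) := by
    rintro q w rfl rfl
    rfl
  exact key _ _ hp h2

/-- `ofCoord φ` is the tangent map of `φ.symm`, once the tangent bundle of the model space is
identified with a product. -/
theorem contMDiffOn_ofCoord [IsManifold 𝓘(ℝ, Coord n) ∞ M]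
    (hφ : φ ∈ IsManifold.maximalAtlas 𝓘(ℝ, Coord n) ∞ M) :
    ContMDiffOn 𝓘(ℝ, Coord n × Coord n) 𝓘(ℝ, Coord n).tangent ∞
      (fun z : Coord n × Coord n => ofCoord φ z.1 z.2) (φ.target ×ˢ Set.univ) := by
  have h1 := (contMDiffOn_symm_of_mem_maximalAtlas hφ).contMDiffOn_tangentMapWithin
    (m := ∞) (by simp) φ.open_target.uniqueMDiffOn
  have h2 : ContMDiff 𝓘(ℝ, Coord n × Coord n) 𝓘(ℝ, Coord n).tangent ∞
      (fun z : Coord n × Coord n => (⟨z.1, z.2⟩ : TangentBundle 𝓘(ℝ, Coord n) (Coord n))) := by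
    have := contMDiff_tangentBundleModelSpaceHomeomorph_symm (I := 𝓘(ℝ, Coord n)) (n := ∞)
    rw [modelWithCornersSelf_prod]
    exact this
  have h3 := h1.comp (s := φ.target ×ˢ Set.univ) h2.contMDiffOn (fun z hz => hz.1)
  refine h3.congr fun z hz => ?_
  have : UniqueMDiffWithinAt 𝓘(ℝ, Coord n) φ.target z.1 := φ.open_target.uniqueMDiffOn _ hz.1
  change _ = tangentMapWithin 𝓘(ℝ, Coord n) 𝓘(ℝ, Coord n) φ.symm φ.target ⟨z.1, z.2⟩
  rw [tangentMapWithin_eq_tangentMap this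
    ((PseudoFinslerMetric.mdiff hφ).mdifferentiableAt_symm hz.1)]
  rfl

theorem isOpen_localDomain [IsManifold 𝓘(ℝ, Coord n) ∞ M]
    (hφ : φ ∈ IsManifold.maximalAtlas 𝓘(ℝ, Coord n) ∞ M) {A : Set (TM n M)} (hA : IsOpen A) :
    IsOpen (localDomain φ A) := by
  have := (contMDiffOn_ofCoord hφ).continuousOn.isOpen_inter_preimage
    (φ.open_target.prod isOpen_univ) hA
  convert this using 1
  ext z
  simp [localDomain]

theorem coordOf_mem_localDomain [IsManifold 𝓘(ℝ, Coord n) ∞ M]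
    (hφ : φ ∈ IsManifold.maximalAtlas 𝓘(ℝ, Coord n) ∞ M) {A : Set (TM n M)} {v : TM n M}
    (hv : v ∈ A) (hvφ : v.proj ∈ φ.source) : coordOf φ v ∈ localDomain φ A :=
  ⟨φ.map_source hvφ, by rwa [ofCoord_coordOf hφ hvφ]⟩

theorem contDiffOn_localRep [IsManifold 𝓘(ℝ, Coord n) ∞ M]
    (hφ : φ ∈ IsManifold.maximalAtlas 𝓘(ℝ, Coord n) ∞ M) {A : Set (TM n M)} {f : TM n M → ℝ}
    (hf : ContMDiffOn 𝓘(ℝ, Coord n).tangent 𝓘(ℝ, ℝ) ∞ f (A ∩ {v | v.proj ∈ φ.source})) :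
    ContDiffOn ℝ ∞ (localRep φ f) (localDomain φ A) := by
  rw [← contMDiffOn_iff_contDiffOn]
  exact hf.comp ((contMDiffOn_ofCoord hφ).mono fun z hz => ⟨hz.1, trivial⟩)
    fun z hz => ⟨hz.2, φ.map_target hz.1⟩

theorem differentiableAt_localRep [IsManifold 𝓘(ℝ, Coord n) ∞ M]
    (hφ : φ ∈ IsManifold.maximalAtlas 𝓘(ℝ, Coord n) ∞ M) {A : Set (TM n M)} (hA : IsOpen A)
    {f : TM n M → ℝ}
    (hf : ContMDiffOn 𝓘(ℝ, Coord n).tangent 𝓘(ℝ, ℝ) ∞ f (A ∩ {v | v.proj ∈ φ.source}))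
    {v : TM n M} (hv : v ∈ A) (hvφ : v.proj ∈ φ.source) :
    DifferentiableAt ℝ (localRep φ f) (coordOf φ v) :=
  ((contDiffOn_localRep hφ hf).contDiffAt ((isOpen_localDomain hφ hA).mem_nhds
    (coordOf_mem_localDomain hφ hv hvφ))).differentiableAt (by simp)

end CoordinateCalculus


/-! ### Second and third derivatives, determinants and `√|t|`. -/

section Calculus

variable {E : Type*} [NormedAddCommGroup E] [NormedSpace ℝ E]

theorem two_le_infty : (2 : WithTop ℕ∞) ≤ ∞ := WithTop.coe_le_coe.2 le_top

theorem fderiv_fderiv_fderiv_apply {f : E → ℝ} {z : E} (hf : ContDiffAt ℝ ∞ f z) (a b c : E) :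
    fderiv ℝ (fun w => fderiv ℝ (fderiv ℝ f) w a b) z c
      = fderiv ℝ (fderiv ℝ (fderiv ℝ f)) z c a b := by
  have h : DifferentiableAt ℝ (fderiv ℝ (fderiv ℝ f)) z :=
    ((hf.fderiv_right (m := ∞) (by simp)).fderiv_right (m := ∞) (by simp)).differentiableAt
      (by simp)
  have h1 := (h.hasFDerivAt.clm_apply (hasFDerivAt_const a z)).clm_apply (hasFDerivAt_const b z)
  rw [h1.fderiv]
  simp

/-- The second derivative of `fderiv ℝ f` is symmetric. Applied to `L`, this gives the total
symmetry of the Cartan tensor. -/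
theorem third_derivative_swap {f : E → ℝ} {z : E} (hf : ContDiffAt ℝ ∞ f z) (a b c : E) :
    fderiv ℝ (fun w => fderiv ℝ (fderiv ℝ f) w a b) z c
      = fderiv ℝ (fun w => fderiv ℝ (fderiv ℝ f) w c b) z a := by
  rw [fderiv_fderiv_fderiv_apply hf, fderiv_fderiv_fderiv_apply hf]
  have h : IsSymmSndFDerivAt ℝ (fderiv ℝ f) z :=
    (hf.fderiv_right (m := ∞) (by simp)).isSymmSndFDerivAt (by simpa using two_le_infty)
  rw [h c a]

theorem contDiffAt_fderiv_fderiv_apply {f : E → ℝ} {z : E} (hf : ContDiffAt ℝ ∞ f z) (a b : E) :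
    ContDiffAt ℝ ∞ (fun w => fderiv ℝ (fderiv ℝ f) w a b) z :=
  (((hf.fderiv_right (m := ∞) (by simp)).fderiv_right (m := ∞) (by simp)).clm_apply
    contDiffAt_const).clm_apply contDiffAt_const

/-- Differentiating `f (c w) = c² f w` twice in `w` produces `c²` on both sides. The derivative
rules for scaling hold without differentiability, so none is assumed. -/
theorem iteratedFDeriv_two_of_homogeneous {f : E → ℝ} {c : ℝ} (hc : 0 < c) {y : E}
    (h0 : (fun w => f (c • w)) =ᶠ[𝓝 y] fun w => c ^ 2 * f w) :
    iteratedFDeriv ℝ 2 f (c • y) = iteratedFDeriv ℝ 2 f y := by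
  have h1 : fderiv ℝ (fun w => f (c • w)) =ᶠ[𝓝 y] fun w => c ^ 2 • fderiv ℝ f w := by
    refine h0.fderiv.trans (Filter.Eventually.of_forall fun w => ?_)
    exact congrFun (fderiv_const_smul_field (c ^ 2)) w
  have h2 : fderiv ℝ (fun w => f (c • w)) = fun w => c • fderiv ℝ f (c • w) := by
    ext1 w
    exact fderiv_comp_smul c
  have h3 := h1.fderiv_eq (𝕜 := ℝ)
  rw [h2] at h3
  have h4 : fderiv ℝ (fun w => c • fderiv ℝ f (c • w)) y
      = c • c • fderiv ℝ (fderiv ℝ f) (c • y) := by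
    have e : fderiv ℝ (fun w => c • fderiv ℝ f (c • w)) y
        = c • fderiv ℝ (fun w => fderiv ℝ f (c • w)) y := by
      exact congrFun (fderiv_const_smul_field (𝕜 := ℝ) (f := fun w => fderiv ℝ f (c • w)) c) y
    rw [e, fderiv_comp_smul (f := fderiv ℝ f)]
  have h5 : fderiv ℝ (fun w => c ^ 2 • fderiv ℝ f w) y = c ^ 2 • fderiv ℝ (fderiv ℝ f) y :=
    congrFun (fderiv_const_smul_field (𝕜 := ℝ) (f := fderiv ℝ f) (c ^ 2)) y
  rw [h4, h5, smul_smul, ← pow_two] at h3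
  have h6 : fderiv ℝ (fderiv ℝ f) (c • y) = fderiv ℝ (fderiv ℝ f) y :=
    smul_right_injective (E →L[ℝ] E →L[ℝ] ℝ) (pow_pos hc 2).ne' h3
  ext m
  rw [iteratedFDeriv_two_apply, iteratedFDeriv_two_apply, h6]

/-- Jacobi's formula: the determinant is multilinear in the rows, and replacing row `i` by its
derivative expands along the cofactors of that row. -/
theorem hasFDerivAt_det {n : ℕ} {A : E → Matrix (Fin n) (Fin n) ℝ}
    {A' : Fin n → Fin n → E →L[ℝ] ℝ} {z : E}
    (h : ∀ i j, HasFDerivAt (fun w => A w i j) (A' i j) z) :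
    HasFDerivAt (fun w => (A w).det) (∑ i, ∑ j, (A z).adjugate j i • A' i j) z := by
  set f : ContinuousMultilinearMap ℝ (fun _ : Fin n => Fin n → ℝ) ℝ :=
    { Matrix.detRowAlternating.toMultilinearMap with
      cont := Continuous.matrix_det continuous_id } with hf
  have hrow : ∀ i, HasFDerivAt (fun w => A w i) (ContinuousLinearMap.pi (A' i)) z :=
    fun i => hasFDerivAt_pi.mpr (h i)
  have h2 := HasFDerivAt.multilinear_comp f hrow
  refine (h2.congr_fderiv ?_ : HasFDerivAt (fun w => f (fun i => A w i)) _ z)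
  ext w
  simp only [sum_apply, ContinuousLinearMap.comp_apply, smul_apply, smul_eq_mul]
  refine Finset.sum_congr rfl fun i _ => ?_
  change ((A z).updateRow i (fun j => A' i j w)).det = _
  rw [← Matrix.cramer_transpose_apply, Matrix.cramer_eq_adjugate_mulVec,
    ← Matrix.adjugate_transpose]
  rfl

/-- In this form the sign of `d` is absorbed, so the signature of `g` plays no role, and the
denominator cancels the determinant in Jacobi's formula. -/
theorem hasDerivAt_sqrt_abs {d : ℝ} (hd : d ≠ 0) :
    HasDerivAt (fun t : ℝ => √|t|) (√|d| / (2 * d)) d := by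
  have h := (Real.hasDerivAt_sqrt (abs_pos.mpr hd).ne').comp d (hasDerivAt_abs hd)
  refine h.congr_deriv ?_
  have hs : √|d| ≠ 0 := (Real.sqrt_pos.mpr (abs_pos.mpr hd)).ne'
  have h2 : √|d| * √|d| = |d| := Real.mul_self_sqrt (abs_nonneg d)
  have h3 : (SignType.sign d : ℝ) * d = |d| := sign_mul_self d
  field_simp
  rw [h3, pow_two, h2]

variable {E' : Type*} [NormedAddCommGroup E'] [NormedSpace ℝ E']

theorem fderiv_fderiv_prodMk_left {f : E × E' → ℝ} {z : E × E'} (hf : ContDiffAt ℝ ∞ f z)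
    (a b : E') :
    fderiv ℝ (fderiv ℝ (fun y => f (z.1, y))) z.2 a b
      = fderiv ℝ (fderiv ℝ f) z (0, a) (0, b) := by
  have hι : ∀ y, HasFDerivAt (fun y : E' => (z.1, y)) (ContinuousLinearMap.inr ℝ E E') y :=
    fun y => hasFDerivAt_prodMk_right _ _
  have hev : ∀ᶠ y in 𝓝 z.2, ContDiffAt ℝ 2 f (z.1, y) := by
    have h1 := (hf.of_le (m := 2) two_le_infty).eventually (by simp)
    exact (hι z.2).continuousAt.eventually h1
  have h1 : fderiv ℝ (fun y => f (z.1, y)) =ᶠ[𝓝 z.2]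
      fun y => (fderiv ℝ f (z.1, y)).comp (ContinuousLinearMap.inr ℝ E E') := by
    filter_upwards [hev] with y hy
    exact (HasFDerivAt.comp y (hy.differentiableAt (by simp)).hasFDerivAt (hι y)).fderiv
  have h2 : HasFDerivAt (fderiv ℝ f) (fderiv ℝ (fderiv ℝ f) z) (z.1, z.2) :=
    ((hf.fderiv_right (m := ∞) (by simp)).differentiableAt (by simp)).hasFDerivAt
  have h3 := (HasFDerivAt.comp z.2 h2 (hι z.2)).clm_comp
    (hasFDerivAt_const (ContinuousLinearMap.inr ℝ E E') z.2)
  rw [h1.fderiv_eq]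
  refine (congrArg (fun L => L a b) h3.fderiv).trans ?_
  simp

theorem fderiv_fderiv_comp_equiv (D : E ≃L[ℝ] E') (h : E' → ℝ) (y a b : E) :
    fderiv ℝ (fderiv ℝ (h ∘ D)) y a b = fderiv ℝ (fderiv ℝ h) (D y) (D a) (D b) := by
  have := D.iteratedFDerivWithin_comp_right h uniqueDiffOn_univ (x := y) (Set.mem_univ _) 2
  simp only [Set.preimage_univ, iteratedFDerivWithin_univ] at this
  have h2 := congrArg (fun L => L ![a, b]) this
  simpa [iteratedFDeriv_two_apply] using h2

end Calculus

/-! ### The fundamental tensor and the Cartan tensor in coordinates. -/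

section FundamentalTensor

variable {n : ℕ} {M : Type*} [TopologicalSpace M] [ChartedSpace (Coord n) M]
  [IsManifold 𝓘(ℝ, Coord n) ∞ M] {φ : OpenPartialHomeomorph M (Coord n)}

namespace PseudoFinslerMetric

variable (F : PseudoFinslerMetric n M)

theorem contDiffAt_localRep_L (hφ : φ ∈ IsManifold.maximalAtlas 𝓘(ℝ, Coord n) ∞ M)
    {z : Coord n × Coord n} (hz : z ∈ localDomain φ F.A) :
    ContDiffAt ℝ ∞ (localRep φ F.L) z :=
  (contDiffOn_localRep hφ (F.smooth_L.mono Set.inter_subset_left)).contDiffAt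
    ((isOpen_localDomain hφ F.isOpen_A).mem_nhds hz)

/-- The vertical Hessian is taken in the fibre itself; the linear isomorphism `D`, the differential
of `φ.symm`, carries it to the coordinates `y` and the standard basis to the frame. -/
theorem localRep_gComp (hφ : φ ∈ IsManifold.maximalAtlas 𝓘(ℝ, Coord n) ∞ M) (i j : Fin n)
    {z : Coord n × Coord n} (hz : z ∈ localDomain φ F.A) :
    localRep φ (F.gComp φ i j) z = 1 / 2 * fderiv ℝ (fderiv ℝ (localRep φ F.L)) z
      (0, EuclideanSpace.single i 1) (0, EuclideanSpace.single j 1) := by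
  rw [← fderiv_fderiv_prodMk_left (F.contDiffAt_localRep_L hφ hz)]
  set D : Coord n ≃L[ℝ] Coord n := (mdiff hφ).symm.mfderiv (x := z.1) hz.1
  have h1 : (fun y => localRep φ F.L (z.1, y))
      = (fun y : Coord n => F.L ⟨φ.symm z.1, y⟩) ∘ D := rfl
  rw [h1, fderiv_fderiv_comp_equiv]
  have key : ∀ (h : Coord n → ℝ) (m : Fin 2 → Coord n), (1 / 2 : ℝ) * iteratedFDeriv ℝ 2 h (D z.2) m
      = 1 / 2 * fderiv ℝ (fderiv ℝ h) (D z.2) (m 0) (m 1) :=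
    fun h m => by rw [iteratedFDeriv_two_apply]
  refine (key _ _).trans ?_
  have hfr : ∀ i, frame φ (ofCoord φ z.1 z.2).proj i = D (EuclideanSpace.single i 1) := by
    intro i
    rw [frame]
    change (mfderiv 𝓘(ℝ, Coord n) 𝓘(ℝ, Coord n) φ.symm (φ (φ.symm z.1)) _ : Coord n) = _
    rw [φ.right_inv hz.1]
    rfl
  simp only [Matrix.cons_val_zero, Matrix.cons_val_one]
  rw [hfr, hfr]
  rfl

theorem localRep_gComp_eventuallyEq (hφ : φ ∈ IsManifold.maximalAtlas 𝓘(ℝ, Coord n) ∞ M)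
    (i j : Fin n) {z : Coord n × Coord n} (hz : z ∈ localDomain φ F.A) :
    localRep φ (F.gComp φ i j) =ᶠ[𝓝 z] fun w => 1 / 2 * fderiv ℝ (fderiv ℝ (localRep φ F.L)) w
      (0, EuclideanSpace.single i 1) (0, EuclideanSpace.single j 1) := by
  filter_upwards [(isOpen_localDomain hφ F.isOpen_A).mem_nhds hz] with w hw
  exact F.localRep_gComp hφ i j hw

theorem differentiableAt_gComp (hφ : φ ∈ IsManifold.maximalAtlas 𝓘(ℝ, Coord n) ∞ M)
    (i j : Fin n) {z : Coord n × Coord n} (hz : z ∈ localDomain φ F.A) :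
    DifferentiableAt ℝ (localRep φ (F.gComp φ i j)) z := by
  refine DifferentiableAt.congr_of_eventuallyEq ?_ (F.localRep_gComp_eventuallyEq hφ i j hz)
  exact ((contDiffAt_fderiv_fderiv_apply (F.contDiffAt_localRep_L hφ hz) _ _).differentiableAt
    (by simp)).const_mul _

theorem localRep_gComp_symm (hφ : φ ∈ IsManifold.maximalAtlas 𝓘(ℝ, Coord n) ∞ M)
    (i j : Fin n) {z : Coord n × Coord n} (hz : z ∈ localDomain φ F.A) :
    localRep φ (F.gComp φ i j) z = localRep φ (F.gComp φ j i) z := by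
  rw [F.localRep_gComp hφ i j hz, F.localRep_gComp hφ j i hz]
  congr 1
  exact (F.contDiffAt_localRep_L hφ hz).isSymmSndFDerivAt (by simpa using two_le_infty) _ _

theorem fderiv_gComp_symm (hφ : φ ∈ IsManifold.maximalAtlas 𝓘(ℝ, Coord n) ∞ M)
    (i j : Fin n) {z : Coord n × Coord n} (hz : z ∈ localDomain φ F.A) :
    fderiv ℝ (localRep φ (F.gComp φ i j)) z = fderiv ℝ (localRep φ (F.gComp φ j i)) z := by
  refine Filter.EventuallyEq.fderiv_eq ?_
  filter_upwards [(isOpen_localDomain hφ F.isOpen_A).mem_nhds hz] with w hw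
  exact F.localRep_gComp_symm hφ i j hw

theorem fderiv_gComp_swap (hφ : φ ∈ IsManifold.maximalAtlas 𝓘(ℝ, Coord n) ∞ M)
    (i j k : Fin n) {z : Coord n × Coord n} (hz : z ∈ localDomain φ F.A) :
    fderiv ℝ (localRep φ (F.gComp φ i j)) z (0, EuclideanSpace.single k 1)
      = fderiv ℝ (localRep φ (F.gComp φ k j)) z (0, EuclideanSpace.single i 1) := by
  rw [(F.localRep_gComp_eventuallyEq hφ i j hz).fderiv_eq,
    (F.localRep_gComp_eventuallyEq hφ k j hz).fderiv_eq]
  have h := F.contDiffAt_localRep_L hφ hz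
  have hd := fun a b => (contDiffAt_fderiv_fderiv_apply h a b).differentiableAt (by simp)
  rw [fderiv_const_mul (hd _ _), fderiv_const_mul (hd _ _)]
  simp only [smul_apply]
  rw [third_derivative_swap h]

theorem g_smul {v : TM n M} (hv : v ∈ F.A) {c : ℝ} (hc : 0 < c) :
    F.g ⟨v.proj, c • v.2⟩ = F.g v := by
  obtain ⟨p, y⟩ := v
  have hopen : IsOpen {y : Coord n | (⟨p, y⟩ : TM n M) ∈ F.A} :=
    F.isOpen_A.preimage (FiberBundle.continuous_totalSpaceMk (Coord n) _ p)
  refine congrArg ((1 / 2 : ℝ) • ·) (iteratedFDeriv_two_of_homogeneous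
    (f := fun y : Coord n => F.L ⟨p, y⟩) hc ?_)
  filter_upwards [hopen.mem_nhds hv] with w hw
  exact F.homogeneous_L ⟨p, w⟩ hw c hc

theorem localRep_gComp_smul (i j : Fin n) {z : Coord n × Coord n} (hz : z ∈ localDomain φ F.A)
    {c : ℝ} (hc : 0 < c) :
    localRep φ (F.gComp φ i j) (z.1, c • z.2) = localRep φ (F.gComp φ i j) z := by
  have h : ofCoord φ z.1 (c • z.2)
      = ⟨(ofCoord φ z.1 z.2).proj, c • (ofCoord φ z.1 z.2).2⟩ := by
    exact congrArg (fun w : Coord n => (⟨φ.symm z.1, w⟩ : TM n M)) (map_smul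
      (mfderiv 𝓘(ℝ, Coord n) 𝓘(ℝ, Coord n) φ.symm z.1 : Coord n →L[ℝ] Coord n) c z.2)
  change F.gComp φ i j (ofCoord φ z.1 (c • z.2)) = _
  rw [h]
  exact congrArg (fun B : ContinuousMultilinearMap ℝ (fun _ : Fin 2 => Coord n) ℝ =>
    B fun a => frame φ (φ.symm z.1) (![i, j] a)) (F.g_smul hz.2 hc)

/-- Euler's relation: `g` is `0`-homogeneous along the ray `c ↦ c y`, so its derivative at `c = 1`
vanishes. -/
theorem fderiv_gComp_radial (hφ : φ ∈ IsManifold.maximalAtlas 𝓘(ℝ, Coord n) ∞ M)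
    (i j : Fin n) {z : Coord n × Coord n} (hz : z ∈ localDomain φ F.A) :
    fderiv ℝ (localRep φ (F.gComp φ i j)) z (0, z.2) = 0 := by
  have h1 : HasDerivAt (fun c : ℝ => (z.1, c • z.2)) (0, z.2) 1 := by
    have := (hasDerivAt_id (1 : ℝ)).smul_const z.2
    simp only [one_smul] at this
    exact (hasDerivAt_const (1 : ℝ) z.1).prodMk this
  have h2 : HasFDerivAt (localRep φ (F.gComp φ i j)) (fderiv ℝ (localRep φ (F.gComp φ i j)) z)
      (z.1, (1 : ℝ) • z.2) := by
    rw [one_smul]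
    exact (F.differentiableAt_gComp hφ i j hz).hasFDerivAt
  have h3 := HasFDerivAt.comp_hasDerivAt (1 : ℝ) h2 h1
  have h4 : (localRep φ (F.gComp φ i j) ∘ fun c : ℝ => (z.1, c • z.2)) =ᶠ[𝓝 1]
      fun _ => localRep φ (F.gComp φ i j) z := by
    filter_upwards [lt_mem_nhds (zero_lt_one (α := ℝ))] with c hc
    exact F.localRep_gComp_smul i j hz hc
  exact h3.unique ((hasDerivAt_const _ _).congr_of_eventuallyEq h4)

variable {v : TM n M}

theorem cartan_eq (hφ : φ ∈ IsManifold.maximalAtlas 𝓘(ℝ, Coord n) ∞ M)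
    (hv : v ∈ F.A) (hvφ : v.proj ∈ φ.source) (i j k : Fin n) :
    F.cartan φ i j k v = 1 / 2 * fderiv ℝ (localRep φ (F.gComp φ i j)) (coordOf φ v)
      (0, EuclideanSpace.single k 1) := by
  rw [cartan, partialY_eq _ (F.differentiableAt_gComp hφ i j (coordOf_mem_localDomain hφ hv hvφ))]

theorem cartan_symm (hφ : φ ∈ IsManifold.maximalAtlas 𝓘(ℝ, Coord n) ∞ M)
    (hv : v ∈ F.A) (hvφ : v.proj ∈ φ.source) (i j k : Fin n) :
    F.cartan φ i j k v = F.cartan φ j i k v := by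
  rw [F.cartan_eq hφ hv hvφ, F.cartan_eq hφ hv hvφ,
    F.fderiv_gComp_symm hφ _ _ (coordOf_mem_localDomain hφ hv hvφ)]

theorem cartan_swap (hφ : φ ∈ IsManifold.maximalAtlas 𝓘(ℝ, Coord n) ∞ M)
    (hv : v ∈ F.A) (hvφ : v.proj ∈ φ.source) (i j k : Fin n) :
    F.cartan φ i j k v = F.cartan φ k j i v := by
  rw [F.cartan_eq hφ hv hvφ, F.cartan_eq hφ hv hvφ,
    F.fderiv_gComp_swap hφ _ _ _ (coordOf_mem_localDomain hφ hv hvφ)]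

theorem sum_cartan_fiberCoord (hφ : φ ∈ IsManifold.maximalAtlas 𝓘(ℝ, Coord n) ∞ M)
    (hv : v ∈ F.A) (hvφ : v.proj ∈ φ.source) (i j : Fin n) :
    ∑ k, F.cartan φ i j k v * fiberCoord φ v k = 0 := by
  have h := F.fderiv_gComp_radial hφ i j (coordOf_mem_localDomain hφ hv hvφ)
  have hy : ((0 : Coord n), (coordOf φ v).2)
      = ∑ k, fiberCoord φ v k • ((0 : Coord n), EuclideanSpace.single k (1 : ℝ)) := by
    refine Prod.ext (by simp [Prod.fst_sum]) ?_
    ext i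
    simp [Prod.snd_sum, coordOf, Pi.single_apply]
  rw [hy, map_sum] at h
  simp only [map_smul, smul_eq_mul] at h
  simp only [F.cartan_eq hφ hv hvφ]
  calc _ = (1 / 2 : ℝ) * ∑ k, (fiberCoord φ v k : ℝ) * fderiv ℝ (localRep φ (F.gComp φ i j))
          (coordOf φ v) (0, EuclideanSpace.single k 1) := by
        rw [Finset.mul_sum]
        exact Finset.sum_congr rfl fun k _ => by ring
    _ = 0 := by rw [h, mul_zero]

end PseudoFinslerMetric

end FundamentalTensor


/-! ### Symmetry, almost-metricity and trace of the Chern symbols. -/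

section ChernConnection

variable {n : ℕ} {M : Type*} [TopologicalSpace M] [ChartedSpace (Coord n) M]
  [IsManifold 𝓘(ℝ, Coord n) ∞ M] {φ : OpenPartialHomeomorph M (Coord n)}

namespace PseudoFinslerMetric

variable (F : PseudoFinslerMetric n M) {v : TM n M}

theorem gComp_symm (hφ : φ ∈ IsManifold.maximalAtlas 𝓘(ℝ, Coord n) ∞ M)
    (hv : v ∈ F.A) (hvφ : v.proj ∈ φ.source) (i j : Fin n) :
    F.gComp φ i j v = F.gComp φ j i v := by
  have h := F.localRep_gComp_symm hφ i j (coordOf_mem_localDomain hφ hv hvφ)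
  simpa only [localRep, ofCoord_coordOf hφ hvφ] using h

theorem gInv_symm (hφ : φ ∈ IsManifold.maximalAtlas 𝓘(ℝ, Coord n) ∞ M)
    (hv : v ∈ F.A) (hvφ : v.proj ∈ φ.source) (i j : Fin n) :
    F.gInv φ i j v = F.gInv φ j i v := by
  have h : (F.gMatrix φ v).transpose = F.gMatrix φ v := by
    ext a b
    exact F.gComp_symm hφ hv hvφ b a
  have h2 := Matrix.transpose_nonsing_inv (F.gMatrix φ v)
  rw [h] at h2
  exact congrFun (congrFun h2 j) i

theorem sum_gComp_gInv (hφ : φ ∈ IsManifold.maximalAtlas 𝓘(ℝ, Coord n) ∞ M)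
    (hv : v ∈ F.A) (hvφ : v.proj ∈ φ.source) (i j : Fin n) :
    ∑ l, F.gComp φ i l v * F.gInv φ l j v = if i = j then 1 else 0 := by
  have h := Matrix.mul_nonsing_inv (F.gMatrix φ v)
    (isUnit_iff_ne_zero.mpr (F.det_gMatrix_ne_zero hφ hv hvφ))
  have h2 := congrFun (congrFun h i) j
  rwa [Matrix.mul_apply, Matrix.one_apply] at h2

theorem delta_gComp_symm (hφ : φ ∈ IsManifold.maximalAtlas 𝓘(ℝ, Coord n) ∞ M)
    (hv : v ∈ F.A) (hvφ : v.proj ∈ φ.source) (N : Fin n → Fin n → TM n M → ℝ) (k i j : Fin n) :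
    delta φ N k (F.gComp φ i j) v = delta φ N k (F.gComp φ j i) v := by
  have hz := coordOf_mem_localDomain hφ hv hvφ
  rw [delta_eq N k (F.differentiableAt_gComp hφ i j hz),
    delta_eq N k (F.differentiableAt_gComp hφ j i hz), F.fderiv_gComp_symm hφ i j hz]

theorem chern_symm (hφ : φ ∈ IsManifold.maximalAtlas 𝓘(ℝ, Coord n) ∞ M)
    (hv : v ∈ F.A) (hvφ : v.proj ∈ φ.source) (i j k : Fin n) :
    F.chern φ i j k v = F.chern φ i k j v := by
  rw [chern, chern]
  congr 1
  refine Finset.sum_congr rfl fun l _ => ?_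
  rw [F.delta_gComp_symm hφ hv hvφ _ l j k]
  ring

theorem sum_gComp_chern (hφ : φ ∈ IsManifold.maximalAtlas 𝓘(ℝ, Coord n) ∞ M)
    (hv : v ∈ F.A) (hvφ : v.proj ∈ φ.source) (m j k : Fin n) :
    ∑ i, F.gComp φ m i v * F.chern φ i j k v
      = 1 / 2 * (delta φ (F.metricN φ) k (F.gComp φ m j) v
        + delta φ (F.metricN φ) j (F.gComp φ m k) v
        - delta φ (F.metricN φ) m (F.gComp φ j k) v) := by
  set B : Fin n → ℝ := fun l => delta φ (F.metricN φ) k (F.gComp φ l j) v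
    + delta φ (F.metricN φ) j (F.gComp φ l k) v - delta φ (F.metricN φ) l (F.gComp φ j k) v
  calc ∑ i, F.gComp φ m i v * F.chern φ i j k v
      = 1 / 2 * ∑ i, ∑ l, F.gComp φ m i v * F.gInv φ i l v * B l := by
        rw [Finset.mul_sum]
        refine Finset.sum_congr rfl fun i _ => ?_
        simp only [chern, Finset.mul_sum]
        exact Finset.sum_congr rfl fun l _ => by ring
    _ = 1 / 2 * ∑ l, (∑ i, F.gComp φ m i v * F.gInv φ i l v) * B l := by
        rw [Finset.sum_comm]
        simp only [Finset.sum_mul]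
    _ = 1 / 2 * B m := by simp [F.sum_gComp_gInv hφ hv hvφ]

/-- The Chern connection is almost metric: its Christoffel symbols parallelize `g` horizontally. -/
theorem delta_gComp_eq (hφ : φ ∈ IsManifold.maximalAtlas 𝓘(ℝ, Coord n) ∞ M)
    (hv : v ∈ F.A) (hvφ : v.proj ∈ φ.source) (k i j : Fin n) :
    delta φ (F.metricN φ) k (F.gComp φ i j) v
      = ∑ l, F.chern φ l k i v * F.gComp φ l j v + ∑ l, F.chern φ l k j v * F.gComp φ i l v := by
  have h1 : ∑ l, F.chern φ l k i v * F.gComp φ l j v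
      = ∑ l, F.gComp φ j l v * F.chern φ l k i v :=
    Finset.sum_congr rfl fun l _ => by rw [F.gComp_symm hφ hv hvφ l j, mul_comm]
  have h2 : ∑ l, F.chern φ l k j v * F.gComp φ i l v
      = ∑ l, F.gComp φ i l v * F.chern φ l k j v :=
    Finset.sum_congr rfl fun l _ => mul_comm _ _
  rw [h1, h2, F.sum_gComp_chern hφ hv hvφ, F.sum_gComp_chern hφ hv hvφ,
    F.delta_gComp_symm hφ hv hvφ _ k j i, F.delta_gComp_symm hφ hv hvφ _ j k i,
    F.delta_gComp_symm hφ hv hvφ _ i j k, F.delta_gComp_symm hφ hv hvφ _ j i k]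
  ring

theorem delta_metricN_gComp (k i j : Fin n) :
    delta φ (F.metricN φ) k (F.gComp φ i j) v
      = partialX φ k (F.gComp φ i j) v - 2 * ∑ m, F.metricN φ m k v * F.cartan φ i j m v := by
  rw [delta, Finset.mul_sum]
  congr 1
  exact Finset.sum_congr rfl fun m _ => by rw [cartan]; ring

theorem sum_cartan_middle (hφ : φ ∈ IsManifold.maximalAtlas 𝓘(ℝ, Coord n) ∞ M)
    (hv : v ∈ F.A) (hvφ : v.proj ∈ φ.source) (i j : Fin n) :
    ∑ k, F.cartan φ i k j v * fiberCoord φ v k = 0 := by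
  rw [← F.sum_cartan_fiberCoord hφ hv hvφ i j]
  refine Finset.sum_congr rfl fun k _ => ?_
  -- Three transpositions move the middle index to the last place.
  rw [F.cartan_swap hφ hv hvφ i k j, F.cartan_symm hφ hv hvφ j k i, F.cartan_swap hφ hv hvφ k j i]

/-- The coefficients `γⁱ_{ab} yᵃ yᵇ` of the geodesic spray. -/
def spray (φ : OpenPartialHomeomorph M (Coord n)) (k : Fin n) (v : TM n M) : ℝ :=
  ∑ a, ∑ b, F.formalChristoffel φ k a b v * fiberCoord φ v a * fiberCoord φ v b

/-- The Cartan correction in `N` meets `y` in an index of `C` and vanishes; only the `γ` part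
remains. -/
theorem sum_metricN_fiberCoord (hφ : φ ∈ IsManifold.maximalAtlas 𝓘(ℝ, Coord n) ∞ M)
    (hv : v ∈ F.A) (hvφ : v.proj ∈ φ.source) (m : Fin n) :
    ∑ k, F.metricN φ m k v * fiberCoord φ v k = F.spray φ m v := by
  have h0 : ∑ k, (∑ q, (∑ l, F.gInv φ m l v * F.cartan φ l k q v) * F.spray φ q v)
      * fiberCoord φ v k = 0 := by
    calc _ = ∑ k, ∑ q, ∑ l, F.gInv φ m l v * F.spray φ q v
          * (F.cartan φ l k q v * fiberCoord φ v k) := by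
          simp only [Finset.sum_mul]
          exact Finset.sum_congr rfl fun k _ => Finset.sum_congr rfl fun q _ =>
            Finset.sum_congr rfl fun l _ => by ring
      _ = ∑ q, ∑ l, F.gInv φ m l v * F.spray φ q v
          * ∑ k, F.cartan φ l k q v * fiberCoord φ v k := by
          rw [Finset.sum_comm]
          refine Finset.sum_congr rfl fun q _ => ?_
          rw [Finset.sum_comm]
          simp only [Finset.mul_sum]
      _ = 0 := by simp [F.sum_cartan_middle hφ hv hvφ]
  have h1 : ∑ k, F.metricN φ m k v * fiberCoord φ v k
      = ∑ k, (∑ l, F.formalChristoffel φ m k l v * fiberCoord φ v l) * fiberCoord φ v k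
        - ∑ k, (∑ q, (∑ l, F.gInv φ m l v * F.cartan φ l k q v) * F.spray φ q v)
      * fiberCoord φ v k := by
    rw [← Finset.sum_sub_distrib]
    exact Finset.sum_congr rfl fun k _ => by rw [← sub_mul]; rfl
  rw [h1, h0, sub_zero, spray]
  refine Finset.sum_congr rfl fun k _ => ?_
  rw [Finset.sum_mul]
  exact Finset.sum_congr rfl fun l _ => by ring

theorem sum_sum_mul_mul (a : Fin n → ℝ) (B : Fin n → Fin n → ℝ) (y : Fin n → ℝ) :
    ∑ k, (∑ l, a l * B l k) * y k = ∑ l, a l * ∑ k, B l k * y k := by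
  simp only [Finset.sum_mul, Finset.mul_sum, mul_assoc]
  exact Finset.sum_comm

/-- The nonlinear connection underlying the Chern connection is the metric one. -/
theorem underlying_chern (hφ : φ ∈ IsManifold.maximalAtlas 𝓘(ℝ, Coord n) ∞ M)
    (hv : v ∈ F.A) (hvφ : v.proj ∈ φ.source) (i j : Fin n) :
    underlying φ (F.chern φ) i j v = F.metricN φ i j v := by
  -- Expanding `δ = ∂ₓ - N ∂_y` in the Chern symbols separates `γ` from three Cartan terms; the
  -- factor `½` is absorbed since `∂g/∂y = 2C`.
  have hΓ : ∀ k, F.chern φ i j k v = F.formalChristoffel φ i j k v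
      - ∑ l, F.gInv φ i l v * ((∑ m, F.metricN φ m k v * F.cartan φ l j m v)
        + (∑ m, F.metricN φ m j v * F.cartan φ l k m v)
        - ∑ m, F.metricN φ m l v * F.cartan φ j k m v) := by
    intro k
    simp only [chern, formalChristoffel, delta_metricN_gComp, Finset.mul_sum (s := Finset.univ)
      (a := (1 / 2 : ℝ))]
    rw [← Finset.sum_sub_distrib]
    exact Finset.sum_congr rfl fun l _ => by ring
  -- Contraction with `y` kills the two terms in which `y` meets `C`. In the third it meets `N` and
  -- yields the spray, which is the correction term in `metricN`.
  have hC : ∀ l, ∑ k, ((∑ m, F.metricN φ m k v * F.cartan φ l j m v)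
        + (∑ m, F.metricN φ m j v * F.cartan φ l k m v)
        - ∑ m, F.metricN φ m l v * F.cartan φ j k m v) * fiberCoord φ v k
      = ∑ m, F.cartan φ l j m v * F.spray φ m v := by
    intro l
    have e : ∀ (a b : Fin n), ∑ k, (∑ m, F.metricN φ m a v * F.cartan φ b k m v)
        * fiberCoord φ v k = 0 := by
      intro a b
      simp only [Finset.sum_mul]
      rw [Finset.sum_comm]
      refine Finset.sum_eq_zero fun m _ => ?_
      simp only [mul_assoc]
      rw [← Finset.mul_sum, F.sum_cartan_middle hφ hv hvφ, mul_zero]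
    simp only [sub_mul, add_mul, Finset.sum_sub_distrib, Finset.sum_add_distrib]
    rw [e, e, add_zero, sub_zero]
    simp only [Finset.sum_mul]
    rw [Finset.sum_comm]
    refine Finset.sum_congr rfl fun m _ => ?_
    rw [← F.sum_metricN_fiberCoord hφ hv hvφ, Finset.mul_sum]
    exact Finset.sum_congr rfl fun k _ => by ring
  rw [underlying, metricN]
  simp only [hΓ, sub_mul, Finset.sum_sub_distrib]
  congr 1
  rw [sum_sum_mul_mul]
  simp only [hC]
  exact (sum_sum_mul_mul (fun l => F.gInv φ i l v) (fun l k => F.cartan φ l j k v)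
    (fun k => F.spray φ k v)).symm

theorem delta_underlying_chern (hφ : φ ∈ IsManifold.maximalAtlas 𝓘(ℝ, Coord n) ∞ M)
    (hv : v ∈ F.A) (hvφ : v.proj ∈ φ.source) (k : Fin n) (f : TM n M → ℝ) :
    delta φ (underlying φ (F.chern φ)) k f v = delta φ (F.metricN φ) k f v := by
  simp only [delta, F.underlying_chern hφ hv hvφ]

/-- The last two terms of the Chern symbols are exchanged by `i ↔ l` and cancel against the
symmetric `gⁱˡ`. -/
theorem sum_chern_trace (hφ : φ ∈ IsManifold.maximalAtlas 𝓘(ℝ, Coord n) ∞ M)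
    (hv : v ∈ F.A) (hvφ : v.proj ∈ φ.source) (k : Fin n) :
    ∑ i, F.chern φ i i k v
      = 1 / 2 * ∑ i, ∑ l, F.gInv φ i l v * delta φ (F.metricN φ) k (F.gComp φ l i) v := by
  have h : ∑ i, ∑ l, F.gInv φ i l v * delta φ (F.metricN φ) i (F.gComp φ l k) v
      = ∑ i, ∑ l, F.gInv φ i l v * delta φ (F.metricN φ) l (F.gComp φ i k) v := by
    rw [Finset.sum_comm]
    exact Finset.sum_congr rfl fun i _ => Finset.sum_congr rfl fun l _ => by
      rw [F.gInv_symm hφ hv hvφ]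
  simp only [chern, mul_sub, mul_add, Finset.sum_sub_distrib, Finset.sum_add_distrib,
    ← Finset.mul_sum]
  rw [h]
  ring

theorem delta_sqrt_det (hφ : φ ∈ IsManifold.maximalAtlas 𝓘(ℝ, Coord n) ∞ M)
    (hv : v ∈ F.A) (hvφ : v.proj ∈ φ.source) (k : Fin n) :
    delta φ (F.metricN φ) k (fun w => √|(F.gMatrix φ w).det|) v
      = √|(F.gMatrix φ v).det| * ∑ i, F.chern φ i i k v := by
  have hz := coordOf_mem_localDomain hφ hv hvφ
  have hdet := F.det_gMatrix_ne_zero hφ hv hvφ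
  have hvv := ofCoord_coordOf hφ hvφ
  set G : Coord n × Coord n → Matrix (Fin n) (Fin n) ℝ := fun z => F.gMatrix φ (ofCoord φ z.1 z.2)
  have hG0 : G (coordOf φ v) = F.gMatrix φ v := congrArg (F.gMatrix φ) hvv
  have h1 := hasFDerivAt_det (A := G) (z := coordOf φ v)
    fun i j => (F.differentiableAt_gComp hφ i j hz).hasFDerivAt
  have h2 : HasFDerivAt (localRep φ fun w => √|(F.gMatrix φ w).det|) _ (coordOf φ v) :=
    HasDerivAt.comp_hasFDerivAt (h₂ := fun t : ℝ => √|t|) (coordOf φ v)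
      (hasDerivAt_sqrt_abs (d := (G (coordOf φ v)).det) (hG0 ▸ hdet)) h1
  rw [delta_eq _ _ h2.differentiableAt, h2.fderiv, F.sum_chern_trace hφ hv hvφ]
  -- Cofactors are `det g` times inverse entries; this `det g` cancels the denominator from
  -- `hasDerivAt_sqrt_abs`.
  have hadj : ∀ i j, (F.gMatrix φ v).adjugate j i = (F.gMatrix φ v).det * F.gInv φ j i v := by
    intro i j
    rw [gInv, Matrix.inv_def, Matrix.smul_apply, Ring.inverse_eq_inv, smul_eq_mul,
      mul_inv_cancel_left₀ hdet]
  have hsum : ∑ i, ∑ j, (F.gMatrix φ v).adjugate j i * delta φ (F.metricN φ) k (F.gComp φ i j) v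
      = (F.gMatrix φ v).det
        * ∑ i, ∑ l, F.gInv φ i l v * delta φ (F.metricN φ) k (F.gComp φ l i) v := by
    rw [Finset.sum_comm, Finset.mul_sum]
    refine Finset.sum_congr rfl fun j _ => ?_
    rw [Finset.mul_sum]
    exact Finset.sum_congr rfl fun i _ => by rw [hadj]; ring
  simp only [smul_apply, sum_apply, smul_eq_mul, hG0,
    ← delta_eq _ _ (F.differentiableAt_gComp hφ _ _ hz)]
  rw [hsum]
  field_simp

end PseudoFinslerMetric

end ChernConnection

/-! ### Bilinear forms, frames and the pointwise operators. -/

theorem update_pair_zero {V : Type*} (a b c : V) : Function.update ![a, b] 0 c = ![c, b] := by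
  funext k
  fin_cases k <;> rfl

theorem update_pair_one {V : Type*} (a b c : V) : Function.update ![a, b] 1 c = ![a, c] := by
  funext k
  fin_cases k <;> rfl

/-- A bilinear form given as a multilinear map in two variables, as a curried map. -/
def bilin {V : Type*} [AddCommGroup V] [Module ℝ V] [TopologicalSpace V]
    (s : ContinuousMultilinearMap ℝ (fun _ : Fin 2 => V) ℝ) : V →ₗ[ℝ] V →ₗ[ℝ] ℝ :=
  LinearMap.mk₂ ℝ (fun a b => s ![a, b])
    (fun a a' b => by
      have h := s.map_update_add ![0, b] 0 a a'
      simpa only [update_pair_zero, update_pair_one] using h)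
    (fun c a b => by
      have h := s.map_update_smul ![0, b] 0 c a
      simpa only [update_pair_zero, update_pair_one] using h)
    (fun a b b' => by
      have h := s.map_update_add ![a, 0] 1 b b'
      simpa only [update_pair_zero, update_pair_one] using h)
    (fun c a b => by
      have h := s.map_update_smul ![a, 0] 1 c b
      simpa only [update_pair_zero, update_pair_one] using h)

theorem bilin_apply {V : Type*} [AddCommGroup V] [Module ℝ V] [TopologicalSpace V]
    (s : ContinuousMultilinearMap ℝ (fun _ : Fin 2 => V) ℝ) (a b : V) :
    bilin s a b = s ![a, b] := rfl

variable {n : ℕ} {M : Type*} [TopologicalSpace M] [ChartedSpace (Coord n) M]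
  {φ : OpenPartialHomeomorph M (Coord n)}

theorem compCov_two (S : CovFieldA n M 2) (i j : Fin n) (v : TM n M) :
    compCov φ S ![i, j] v = bilin (S v) (frame φ v.proj i) (frame φ v.proj j) := by
  rw [compCov, bilin_apply]
  congr 1
  funext a
  fin_cases a <;> rfl

/-- The terms in `δS` cancel because both operators use the same nonlinear connection. Swapping the
lower indices of `Γ` turns the remaining connection terms into those of `∇X`, which complete `δX` to
`∇X` in each slot. -/
theorem lieCov_coeff_sub_nablaCov_coeff {s : ℕ} (N : Fin n → Fin n → TM n M → ℝ)
    (Γ : Fin n → Fin n → Fin n → TM n M → ℝ) (X : VectorFieldA n M) (S : CovFieldA n M s)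
    {v : TM n M} (hN : ∀ i j, underlying φ Γ i j v = N i j v)
    (hΓ : ∀ i j k, Γ i j k v = Γ i k j v) (J : Fin s → Fin n) :
    ((∑ k, compVec φ X k v * delta φ N k (compCov φ S J) v)
        + ∑ a, ∑ k, delta φ N (J a) (compVec φ X k) v * compCov φ S (Function.update J a k) v)
      - ∑ k, compVec φ X k v * (delta φ (underlying φ Γ) k (compCov φ S J) v
        - ∑ a, ∑ l, Γ l k (J a) v * compCov φ S (Function.update J a l) v)
      = ∑ a, ∑ k, (delta φ (underlying φ Γ) (J a) (compVec φ X k) v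
          + ∑ l, Γ k (J a) l v * compVec φ X l v) * compCov φ S (Function.update J a k) v := by
  have hd : ∀ k f, delta φ (underlying φ Γ) k f v = delta φ N k f v := by
    intro k f
    simp only [delta, hN]
  have h : ∑ k, compVec φ X k v * ∑ a, ∑ l, Γ l k (J a) v * compCov φ S (Function.update J a l) v
      = ∑ a, ∑ l, (∑ k, Γ l (J a) k v * compVec φ X k v)
        * compCov φ S (Function.update J a l) v := by
    simp only [Finset.mul_sum, Finset.sum_mul]
    rw [Finset.sum_comm]
    refine Finset.sum_congr rfl fun a _ => ?_
    rw [Finset.sum_comm]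
    exact Finset.sum_congr rfl fun l _ => Finset.sum_congr rfl fun k _ => by
      rw [hΓ l k (J a)]; ring
  simp only [hd, mul_sub, add_mul, Finset.sum_sub_distrib, Finset.sum_add_distrib]
  rw [h]
  ring

variable [IsManifold 𝓘(ℝ, Coord n) ∞ M]

/-- An endomorphism is the sum of the rank-one maps `dxⁱ ⊗ f(∂ᵢ)`, whose traces are known. -/
theorem trace_eq_sum_dx (hφ : φ ∈ IsManifold.maximalAtlas 𝓘(ℝ, Coord n) ∞ M) {p : M}
    (hp : p ∈ φ.source) (f : Tan n p →ₗ[ℝ] Tan n p) :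
    LinearMap.trace ℝ (Tan n p) f = ∑ i, dx φ p i (f (frame φ p i)) := by
  have hf : f = ∑ i, (dx φ p i : Tan n p →ₗ[ℝ] ℝ).smulRight (f (frame φ p i)) := by
    ext u
    conv_lhs => rw [PseudoFinslerMetric.sum_dx_frame hφ hp u]
    simp
  have : Module.Finite ℝ (Tan n p) := inferInstanceAs (Module.Finite ℝ (Coord n))
  conv_lhs => rw [hf, map_sum]
  simp only [LinearMap.trace_smulRight]
  rfl

theorem bilinear_eq_zero_iff (hφ : φ ∈ IsManifold.maximalAtlas 𝓘(ℝ, Coord n) ∞ M) {p : M}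
    (hp : p ∈ φ.source) (Q : Tan n p →ₗ[ℝ] Tan n p →ₗ[ℝ] ℝ) :
    (∀ a b, Q a b = 0) ↔ ∀ i j, Q (frame φ p i) (frame φ p j) = 0 := by
  refine ⟨fun h i j => h _ _, fun h a b => ?_⟩
  rw [PseudoFinslerMetric.sum_dx_frame hφ hp a, PseudoFinslerMetric.sum_dx_frame hφ hp b]
  simp [h]

theorem nablaVec_frame (hφ : φ ∈ IsManifold.maximalAtlas 𝓘(ℝ, Coord n) ∞ M)
    (Γ : Fin n → Fin n → Fin n → TM n M → ℝ) (X : VectorFieldA n M) {v : TM n M}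
    (hv : v.proj ∈ φ.source) (k : Fin n) :
    nablaVec φ Γ X v (frame φ v.proj k) = ∑ i, (delta φ (underlying φ Γ) k (compVec φ X i) v
      + ∑ l, Γ i k l v * compVec φ X l v) • frame φ v.proj i := by
  simp only [nablaVec, sum_apply, smul_apply, ContinuousLinearMap.smulRight_apply,
    PseudoFinslerMetric.dx_frame hφ hv]
  rw [Finset.sum_eq_single k]
  · simp
  · intro b _ hb
    simp [hb]
  · simp

theorem nablaEnd_frame (hφ : φ ∈ IsManifold.maximalAtlas 𝓘(ℝ, Coord n) ∞ M)
    (Γ : Fin n → Fin n → Fin n → TM n M → ℝ) (T : EndFieldA n M) {v : TM n M}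
    (hv : v.proj ∈ φ.source) (k m : Fin n) (w : Tan n v.proj) :
    dx φ v.proj m (nablaEnd φ Γ T v (frame φ v.proj k) w)
      = ∑ j, (delta φ (underlying φ Γ) k (compEnd φ T m j) v
        + ∑ l, Γ m k l v * compEnd φ T l j v - ∑ l, Γ l k j v * compEnd φ T m l v)
        * dx φ v.proj j w := by
  simp only [nablaEnd, sum_apply, smul_apply, ContinuousLinearMap.smulRight_apply,
    PseudoFinslerMetric.dx_frame hφ hv, map_sum, map_smul, smul_eq_mul]
  rw [Finset.sum_eq_single k]
  · rw [Finset.sum_eq_single m]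
    · simp
    · intro b _ hb
      simp [hb.symm]
    · simp
  · intro b _ hb
    simp [hb]
  · simp

/-! ### Lie bracket against covariant derivative, and traces computed with `g`. -/

namespace PseudoFinslerMetric

variable (F : PseudoFinslerMetric n M) {v : TM n M}

theorem lieCov_two_sub_nablaCov (hφ : φ ∈ IsManifold.maximalAtlas 𝓘(ℝ, Coord n) ∞ M)
    (hv : v ∈ F.A) (hvφ : v.proj ∈ φ.source) (X : VectorFieldA n M) (S : CovFieldA n M 2)
    (i j : Fin n) :
    compCov φ (lieCov φ (F.metricN φ) X S) ![i, j] v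
        - compCov φ (nablaCov φ (F.chern φ) X S) ![i, j] v
      = S v ![F.nabla φ X v (frame φ v.proj i), frame φ v.proj j]
        + S v ![frame φ v.proj i, F.nabla φ X v (frame φ v.proj j)] := by
  rw [compCov_sum hφ _ _ hvφ rfl, compCov_sum hφ _ _ hvφ rfl,
    lieCov_coeff_sub_nablaCov_coeff _ _ X S (F.underlying_chern hφ hv hvφ)
      (F.chern_symm hφ hv hvφ), Fin.sum_univ_two, ← bilin_apply, ← bilin_apply, nabla,
    nablaVec_frame hφ _ _ hvφ, nablaVec_frame hφ _ _ hvφ]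
  simp only [update_pair_zero, update_pair_one, compCov_two, map_sum, map_smul, LinearMap.sum_apply,
    LinearMap.smul_apply, smul_eq_mul, Matrix.cons_val_zero, Matrix.cons_val_one]

theorem eq_of_compCov_two (hφ : φ ∈ IsManifold.maximalAtlas 𝓘(ℝ, Coord n) ∞ M)
    (hvφ : v.proj ∈ φ.source) {S S' : CovFieldA n M 2}
    (h : ∀ i j, compCov φ S ![i, j] v = compCov φ S' ![i, j] v) : S v = S' v := by
  have h0 : ∀ a b, (bilin (S v) - bilin (S' v)) a b = 0 := by
    rw [bilinear_eq_zero_iff hφ hvφ]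
    intro i j
    have := h i j
    rw [compCov_two, compCov_two] at this
    simp [this]
  ext m
  have h1 := h0 (m 0) (m 1)
  have hm : m = ![m 0, m 1] := by
    funext k
    fin_cases k <;> rfl
  rw [hm]
  simpa [bilin_apply, sub_eq_zero] using h1

theorem lieCov_eq_nablaCov_iff (hφ : φ ∈ IsManifold.maximalAtlas 𝓘(ℝ, Coord n) ∞ M)
    (hv : v ∈ F.A) (hvφ : v.proj ∈ φ.source) (X : VectorFieldA n M) (S : CovFieldA n M 2) :
    lieCov φ (F.metricN φ) X S v = nablaCov φ (F.chern φ) X S v ↔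
      ∀ a b : Tan n v.proj, S v ![F.nabla φ X v a, b] = -S v ![a, F.nabla φ X v b] := by
  have h1 : lieCov φ (F.metricN φ) X S v = nablaCov φ (F.chern φ) X S v ↔
      ∀ i j, compCov φ (lieCov φ (F.metricN φ) X S) ![i, j] v
        - compCov φ (nablaCov φ (F.chern φ) X S) ![i, j] v = 0 := by
    refine ⟨fun h i j => ?_, fun h => ?_⟩
    · rw [compCov, compCov, h, sub_self]
    · exact eq_of_compCov_two hφ hvφ fun i j => sub_eq_zero.mp (h i j)
  have h2 := bilinear_eq_zero_iff hφ hvφ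
    ((bilin (S v)).comp (F.nabla φ X v : Tan n v.proj →ₗ[ℝ] Tan n v.proj)
      + (bilin (S v)).compl₂ (F.nabla φ X v : Tan n v.proj →ₗ[ℝ] Tan n v.proj))
  rw [h1]
  simp only [F.lieCov_two_sub_nablaCov hφ hv hvφ]
  refine h2.symm.trans ?_
  simp only [eq_neg_iff_add_eq_zero]
  rfl

/-- This turns `𝔩ᴴ_X g = 0` into the case `S = g` of (Aiii). -/
theorem nablaCov_g (hφ : φ ∈ IsManifold.maximalAtlas 𝓘(ℝ, Coord n) ∞ M)
    (hv : v ∈ F.A) (hvφ : v.proj ∈ φ.source) (X : VectorFieldA n M) :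
    nablaCov φ (F.chern φ) X F.g v = 0 := by
  refine eq_of_compCov_two (S' := fun _ => 0) hφ hvφ fun i j => ?_
  rw [compCov_sum hφ _ _ hvφ rfl]
  refine Finset.sum_eq_zero fun k _ => ?_
  have h := F.delta_gComp_eq hφ hv hvφ k i j
  rw [F.delta_underlying_chern hφ hv hvφ, Fin.sum_univ_two]
  simp only [update_pair_zero, update_pair_one, Matrix.cons_val_zero, Matrix.cons_val_one]
  change _ * (delta φ (F.metricN φ) k (F.gComp φ i j) v - (∑ l, F.chern φ l k i v * F.gComp φ l j v
    + ∑ l, F.chern φ l k j v * F.gComp φ i l v)) = 0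
  rw [h, sub_self, mul_zero]

theorem dx_eq_sum_gInv (hφ : φ ∈ IsManifold.maximalAtlas 𝓘(ℝ, Coord n) ∞ M)
    (hv : v ∈ F.A) (hvφ : v.proj ∈ φ.source) (i : Fin n) (u : Tan n v.proj) :
    dx φ v.proj i u = ∑ j, F.gInv φ j i v * F.g v ![frame φ v.proj j, u] := by
  have h : ∀ j, F.g v ![frame φ v.proj j, u] = ∑ m, dx φ v.proj m u * F.gComp φ m j v := by
    intro j
    rw [← bilin_apply]
    conv_lhs => rw [sum_dx_frame hφ hvφ u]
    simp only [map_sum, map_smul, smul_eq_mul]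
    exact Finset.sum_congr rfl fun m _ => by
      rw [F.gComp_symm hφ hv hvφ, gComp, compCov_two]
  simp only [h, Finset.mul_sum]
  rw [Finset.sum_comm]
  have h2 : ∀ m, ∑ j, F.gInv φ j i v * (dx φ v.proj m u * F.gComp φ m j v)
      = dx φ v.proj m u * ∑ j, F.gComp φ m j v * F.gInv φ j i v := by
    intro m
    rw [Finset.mul_sum]
    exact Finset.sum_congr rfl fun j _ => by ring
  simp [h2, F.sum_gComp_gInv hφ hv hvφ]

/-- Raising an index gives `trace E = gʲⁱ g(∂ⱼ, E ∂ᵢ)`; the hypothesis exchanges the two frame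
vectors, and `gʲⁱ` is symmetric. It serves (Ci) with `E' = E` and (Cii) with `E' = ∇X ∘ T`. -/
theorem trace_eq_neg_trace_of_adjoint (hφ : φ ∈ IsManifold.maximalAtlas 𝓘(ℝ, Coord n) ∞ M)
    (hv : v ∈ F.A) (hvφ : v.proj ∈ φ.source) (E E' : Tan n v.proj →ₗ[ℝ] Tan n v.proj)
    (h : ∀ a b, F.g v ![a, E b] = -F.g v ![b, E' a]) :
    LinearMap.trace ℝ (Tan n v.proj) E = -LinearMap.trace ℝ (Tan n v.proj) E' := by
  rw [trace_eq_sum_dx hφ hvφ, trace_eq_sum_dx hφ hvφ]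
  simp only [F.dx_eq_sum_gInv hφ hv hvφ]
  rw [Finset.sum_comm, ← Finset.sum_neg_distrib]
  refine Finset.sum_congr rfl fun i _ => ?_
  rw [← Finset.sum_neg_distrib]
  refine Finset.sum_congr rfl fun j _ => ?_
  rw [h, F.gInv_symm hφ hv hvφ i j, mul_neg]

/-! ### The divergence as the trace of `∇Z`, and parts (B) and (C). -/

theorem divergence_eq (hφ : φ ∈ IsManifold.maximalAtlas 𝓘(ℝ, Coord n) ∞ M)
    (hv : v ∈ F.A) (hvφ : v.proj ∈ φ.source) (Z : VectorFieldA n M) :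
    F.divergence φ Z v = (∑ k, compVec φ Z k v * ∑ i, F.chern φ i i k v)
      + ∑ a, delta φ (F.metricN φ) a (compVec φ Z a) v := by
  have hcomp : ∀ w : TM n M, w.proj ∈ φ.source → ∀ J : Fin n → Fin n,
      compCov φ (F.dVol φ) J w = √|(F.gMatrix φ w).det| * eps J :=
    fun w hw J => compCov_sum hφ _ _ hw (F.dVol_eq w) J
  have hid : eps (id : Fin n → Fin n) = 1 := by
    simpa using eps_perm (1 : Equiv.Perm (Fin n))
  have hpos : √|(F.gMatrix φ v).det| ≠ 0 :=
    (Real.sqrt_pos.mpr (abs_pos.mpr (F.det_gMatrix_ne_zero hφ hv hvφ))).ne'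
  have hδ : ∀ k, delta φ (F.metricN φ) k (compCov φ (F.dVol φ) id) v
      = √|(F.gMatrix φ v).det| * ∑ i, F.chern φ i i k v := by
    intro k
    rw [← F.delta_sqrt_det hφ hv hvφ]
    refine Eq.trans ?_ (one_mul _)
    -- The constant `1` makes this a locality statement: `δₖ` depends only on values over the chart
    -- domain.
    exact delta_const_mul _ _ _ _ 1 (fun w hw => by rw [hcomp w hw, hid, one_mul, mul_one]) hvφ
  -- Changing one entry of `id` leaves a permutation only when `k = a`, so the double sum reduces to
  -- its diagonal.
  have hsum : ∑ a, ∑ k, delta φ (F.metricN φ) (id a) (compVec φ Z k) v *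
        compCov φ (F.dVol φ) (Function.update id a k) v
      = √|(F.gMatrix φ v).det| * ∑ a, delta φ (F.metricN φ) a (compVec φ Z a) v := by
    have h := sum_eps_update (fun j k => delta φ (F.metricN φ) j (compVec φ Z k) v) id
    rw [hid, mul_one] at h
    rw [← h]
    simp only [hcomp v hvφ, Finset.mul_sum]
    exact Finset.sum_congr rfl fun a _ => Finset.sum_congr rfl fun k _ => by ring
  rw [divergence, compCov_sum hφ _ _ hvφ rfl, hsum, hcomp v hvφ, hid, mul_one,
    div_eq_iff hpos]
  simp only [hδ]
  rw [add_mul, Finset.sum_mul]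
  congr 1
  · exact Finset.sum_congr rfl fun k _ => by ring
  · ring

theorem compVec_apply (hφ : φ ∈ IsManifold.maximalAtlas 𝓘(ℝ, Coord n) ∞ M)
    (hvφ : v.proj ∈ φ.source) (T : EndFieldA n M) (X : VectorFieldA n M) (i : Fin n) :
    compVec φ (fun w => T w (X w)) i v = ∑ j, compEnd φ T i j v * compVec φ X j v := by
  rw [compVec]
  conv_lhs => rw [sum_dx_frame hφ hvφ (X v)]
  simp only [map_sum, map_smul, smul_eq_mul]
  exact Finset.sum_congr rfl fun j _ => mul_comm _ _

/-- The Leibniz rule for `Tⁱⱼ Xʲ`; the smoothness of `T` and `X` enters (B) here. -/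
theorem delta_compVec_apply (hφ : φ ∈ IsManifold.maximalAtlas 𝓘(ℝ, Coord n) ∞ M)
    (hv : v ∈ F.A) (hvφ : v.proj ∈ φ.source) {T : EndFieldA n M} (hT : SmoothEnd F.A T)
    {X : VectorFieldA n M} (hX : SmoothVec F.A X) (N : Fin n → Fin n → TM n M → ℝ)
    (k i : Fin n) :
    delta φ N k (compVec φ (fun w => T w (X w)) i) v
      = ∑ j, (delta φ N k (compEnd φ T i j) v * compVec φ X j v
        + compEnd φ T i j v * delta φ N k (compVec φ X j) v) := by
  have hTd := fun j => differentiableAt_localRep hφ F.isOpen_A (hT φ hφ i j) hv hvφ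
  have hXd := fun j => differentiableAt_localRep hφ F.isOpen_A (hX φ hφ j) hv hvφ
  have hev : localRep φ (compVec φ (fun w => T w (X w)) i) =ᶠ[𝓝 (coordOf φ v)]
      fun z => ∑ j, localRep φ (compEnd φ T i j) z * localRep φ (compVec φ X j) z := by
    filter_upwards [(isOpen_localDomain hφ F.isOpen_A).mem_nhds
      (coordOf_mem_localDomain hφ hv hvφ)] with z hz
    exact compVec_apply hφ (φ.map_target hz.1) T X i
  have hd : HasFDerivAt
      (fun z => ∑ j, localRep φ (compEnd φ T i j) z * localRep φ (compVec φ X j) z)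
      _ (coordOf φ v) :=
    HasFDerivAt.fun_sum fun j _ => (hTd j).hasFDerivAt.mul (hXd j).hasFDerivAt
  rw [delta_eq _ _ (hd.differentiableAt.congr_of_eventuallyEq hev), hev.fderiv_eq, hd.fderiv]
  have hval : ∀ f : TM n M → ℝ, localRep φ f (coordOf φ v) = f v := fun f =>
    congrArg f (ofCoord_coordOf hφ hvφ)
  simp only [sum_apply, add_apply, smul_apply, smul_eq_mul, hval, delta_eq _ _ (hTd _),
    delta_eq _ _ (hXd _)]
  exact Finset.sum_congr rfl fun j _ => by ring

theorem trace_comp_nabla (hφ : φ ∈ IsManifold.maximalAtlas 𝓘(ℝ, Coord n) ∞ M)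
    (hv : v ∈ F.A) (hvφ : v.proj ∈ φ.source) (T : EndFieldA n M) (X : VectorFieldA n M) :
    LinearMap.trace ℝ (Tan n v.proj) (T v ∘L F.nabla φ X v).toLinearMap
      = ∑ k, ∑ i, (delta φ (F.metricN φ) k (compVec φ X i) v
        + ∑ l, F.chern φ i k l v * compVec φ X l v) * compEnd φ T k i v := by
  rw [trace_eq_sum_dx hφ hvφ]
  refine Finset.sum_congr rfl fun k _ => ?_
  change dx φ v.proj k (T v (F.nabla φ X v (frame φ v.proj k))) = _
  rw [nabla, nablaVec_frame hφ _ _ hvφ]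
  simp only [map_sum, map_smul, smul_eq_mul, F.delta_underlying_chern hφ hv hvφ]
  rfl

theorem contractDir_nablaEnd (hφ : φ ∈ IsManifold.maximalAtlas 𝓘(ℝ, Coord n) ∞ M)
    (hv : v ∈ F.A) (hvφ : v.proj ∈ φ.source) (T : EndFieldA n M) (X : VectorFieldA n M) :
    contractDir (nablaEnd φ (F.chern φ) T v) (X v)
      = ∑ k, ∑ j, (delta φ (F.metricN φ) k (compEnd φ T k j) v
        + ∑ l, F.chern φ k k l v * compEnd φ T l j v - ∑ l, F.chern φ l k j v * compEnd φ T k l v)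
        * compVec φ X j v := by
  rw [contractDir, trace_eq_sum_dx hφ hvφ]
  refine Finset.sum_congr rfl fun k _ => ?_
  refine (nablaEnd_frame hφ (F.chern φ) T hvφ k k (X v)).trans ?_
  simp only [F.delta_underlying_chern hφ hv hvφ]
  rfl

/-- After the Leibniz rule the terms `T δX` cancel. The trace `Γⁱᵢₖ` from the volume is the
upper-index correction of the contracted `∇T` (`h1`), and the `Γ` part of `∇X` is its lower-index
correction (`h2`). -/
theorem divergence_apply_sub_trace (hφ : φ ∈ IsManifold.maximalAtlas 𝓘(ℝ, Coord n) ∞ M)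
    (hv : v ∈ F.A) (hvφ : v.proj ∈ φ.source) {T : EndFieldA n M} (hT : SmoothEnd F.A T)
    {X : VectorFieldA n M} (hX : SmoothVec F.A X) :
    F.divergence φ (fun w => T w (X w)) v
        - LinearMap.trace ℝ (Tan n v.proj) (T v ∘L F.nabla φ X v).toLinearMap
      = contractDir (nablaEnd φ (F.chern φ) T v) (X v) := by
  rw [F.divergence_eq hφ hv hvφ, F.trace_comp_nabla hφ hv hvφ, F.contractDir_nablaEnd hφ hv hvφ]
  simp only [F.delta_compVec_apply hφ hv hvφ hT hX, compVec_apply hφ hvφ]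
  have h1 : ∑ k, (∑ j, compEnd φ T k j v * compVec φ X j v) * ∑ i, F.chern φ i i k v
      = ∑ k, ∑ j, (∑ l, F.chern φ k k l v * compEnd φ T l j v) * compVec φ X j v := by
    simp only [Finset.sum_mul, Finset.mul_sum]
    rw [Finset.sum_comm]
    refine Finset.sum_congr rfl fun i _ => ?_
    rw [Finset.sum_comm]
    exact Finset.sum_congr rfl fun j _ => Finset.sum_congr rfl fun l _ => by ring
  have h2 : ∑ k, ∑ i, (∑ l, F.chern φ i k l v * compVec φ X l v) * compEnd φ T k i v
      = ∑ k, ∑ j, (∑ l, F.chern φ l k j v * compEnd φ T k l v) * compVec φ X j v := by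
    refine Finset.sum_congr rfl fun k _ => ?_
    simp only [Finset.sum_mul]
    rw [Finset.sum_comm]
    exact Finset.sum_congr rfl fun j _ => Finset.sum_congr rfl fun l _ => by ring
  simp only [add_mul, sub_mul, Finset.sum_add_distrib, Finset.sum_sub_distrib]
  rw [h1, h2]
  have h3 : ∑ k, ∑ i, delta φ (F.metricN φ) k (compVec φ X i) v * compEnd φ T k i v
      = ∑ k, ∑ i, compEnd φ T k i v * delta φ (F.metricN φ) k (compVec φ X i) v :=
    Finset.sum_congr rfl fun k _ => Finset.sum_congr rfl fun i _ => mul_comm _ _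
  rw [h3]
  ring

theorem trace_comp_nabla_eq_zero (hφ : φ ∈ IsManifold.maximalAtlas 𝓘(ℝ, Coord n) ∞ M)
    (hv : v ∈ F.A) (hvφ : v.proj ∈ φ.source) (T : EndFieldA n M) (X : VectorFieldA n M)
    (h : (∀ a b : Tan n v.proj,
          F.flat T v a (F.nabla φ X v b) = -F.flat T v b (F.nabla φ X v a)) ∨
        ((∀ a b : Tan n v.proj, F.flat T v a b = F.flat T v b a) ∧
          lieCov φ (F.metricN φ) X F.g v = 0)) :
    LinearMap.trace ℝ (Tan n v.proj) (T v ∘L F.nabla φ X v).toLinearMap = 0 := by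
  set E := (T v ∘L F.nabla φ X v).toLinearMap with hE
  rcases h with h | ⟨hT, hg⟩
  · have := F.trace_eq_neg_trace_of_adjoint hφ hv hvφ E E h
    linarith
  · rw [← F.nablaCov_g hφ hv hvφ X, F.lieCov_eq_nablaCov_iff hφ hv hvφ] at hg
    have h1 := F.trace_eq_neg_trace_of_adjoint hφ hv hvφ E
      ((F.nabla φ X v).toLinearMap * (T v).toLinearMap) fun a b => by
        calc F.g v ![a, T v (F.nabla φ X v b)] = F.g v ![F.nabla φ X v b, T v a] := hT _ _
          _ = -F.g v ![b, F.nabla φ X v (T v a)] := hg _ _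
    have h2 : E = (T v).toLinearMap * (F.nabla φ X v).toLinearMap := rfl
    -- Cyclicity identifies the trace of `∇X ∘ T` with that of `E`, leaving `trace E = -trace E`.
    rw [LinearMap.trace_mul_comm, ← h2] at h1
    linarith

end PseudoFinslerMetric

end AnisotropicTensors

end

open AnisotropicTensors in
theorem mainTheorem6 {n : ℕ} {M : Type*} [TopologicalSpace M] [ChartedSpace (Coord n) M]
    [IsManifold 𝓘(ℝ, Coord n) ∞ M] (F : PseudoFinslerMetric n M)
    (S : CovFieldA n M 2) (hS : SmoothCov F.A S)
    (hSsymm : ∀ v ∈ F.A, ∀ a b : Tan n v.proj, S v ![a, b] = S v ![b, a])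
    (T : EndFieldA n M) (hT : SmoothEnd F.A T)
    (X : VectorFieldA n M) (hX : SmoothVec F.A X)
    (φ : OpenPartialHomeomorph M (Coord n))
    (hφ : φ ∈ IsManifold.maximalAtlas 𝓘(ℝ, Coord n) ∞ M)
    (v : TM n M) (hv : v ∈ F.A) (hvφ : v.proj ∈ φ.source) :
    -- part (A)
    List.TFAE [
      ∀ a b : Tan n v.proj, S v ![a, F.nabla φ X v b] = -S v ![b, F.nabla φ X v a],
      ∀ a b : Tan n v.proj, S v ![F.nabla φ X v a, b] = -S v ![a, F.nabla φ X v b],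
      lieCov φ (F.metricN φ) X S v = nablaCov φ (F.chern φ) X S v] ∧
    -- part (B)
    F.divergence φ (fun w => T w (X w)) v
        - LinearMap.trace ℝ (Tan n v.proj) (T v ∘L F.nabla φ X v).toLinearMap
      = contractDir (nablaEnd φ (F.chern φ) T v) (X v) ∧
    -- part (C)
    ((∀ a b : Tan n v.proj,
          F.flat T v a (F.nabla φ X v b) = -F.flat T v b (F.nabla φ X v a)) ∨
        ((∀ a b : Tan n v.proj, F.flat T v a b = F.flat T v b a) ∧
          lieCov φ (F.metricN φ) X F.g v = 0) →
      LinearMap.trace ℝ (Tan n v.proj) (T v ∘L F.nabla φ X v).toLinearMap = 0) := by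
  refine ⟨?_, F.divergence_apply_sub_trace hφ hv hvφ hT hX,
    F.trace_comp_nabla_eq_zero hφ hv hvφ T X⟩
  tfae_have 1 ↔ 2 := by
    refine ⟨fun h a b => ?_, fun h a b => ?_⟩
    · rw [hSsymm v hv, h b a]
    · rw [hSsymm v hv b, h a b, neg_neg]
  tfae_have 3 ↔ 2 := F.lieCov_eq_nablaCov_iff hφ hv hvφ X S
  tfae_finish
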